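/- \textbf{Conventions.} Alphabets are finite sets with at least two letters. A bi-infinite word $x\in\mathcal A^{\mathbb Z}$ is \emph{over} $\mathcal A$ if every letter of $\mathcal A$ appears in $x$; $\mathcal L(x)$ denotes the set of its finite factors (including the empty word). For $w\in\mathcal L(x)$, the \emph{extension graph} of $w$ in $x$ is the undirected bipartite graph whose vertex set is the disjoint union of $E^-_x(w)=\{a\in\mathcal A: aw\in\mathcal L(x)\}$ and $E^+_x(w)=\{b\in\mathcal A: wb\in\mathcal L(x)\}$, with an edge between the left vertex $a$ and the right vertex $b$ if and only if $awb\in\mathcal L(x)$. The word $x$ is \emph{dendric} if the extension graph of every $w\in\mathcal L(x)$ is a tree. A \emph{morphism} $\sigma:\mathcal A^*\to\mathcal B^*$ is a monoid homomorphism between free monoids such that every letter of $\mathcal B$ appears in the image of some word. It is \emph{non-erasing} if $\sigma(a)\neq\varepsilon$ for every letter $a$; it then acts on bi-infinite words by $\sigma(x)=\cdots\sigma(x_{-2})\sigma(x_{-1})\,.\,\sigma(x_0)\sigma(x_1)\cdots$. It is \emph{dendric preserving} if $\sigma(x)$ is dendric for every dendric bi-infinite word $x$ over $\mathcal A$. A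 \emph{bijective coding} is a morphism that maps the letters to pairwise distinct single letters. For $\ell\in\mathcal A$, the \emph{Arnoux--Rauzy morphisms} $L_\ell,R_\ell:\mathcal A^*\to\mathcal A^*$ are given by $L_\ell(\ell)=R_\ell(\ell)=\ell$ and $L_\ell(a)=\ell a$, $R_\ell(a)=a\ell$ for $a\in\mathcal A\setminus\{\ell\}$. Let $AR_{\mathcal A}$ be the monoid, under composition, generated by all the $L_\ell$ and $R_\ell$, $\ell\in\mathcal A$. \textbf{Theorem.} Let $\sigma:\mathcal A^*\to\mathcal B^*$ be a non-erasing morphism. Then $\sigma$ is dendric preserving if and only if it is, up to a bijective coding, in $AR_{\mathcal A}$, i.e. if and only if there exist a bijective coding $\kappa:\mathcal A^*\to\mathcal B^*$ and $\tau\in AR_{\mathcal A}$ such that $\sigma=\kappa\circ\tau$. -/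

import Mathlib

namespace Dendric

variable {A B : Type*}

/-! ### Bi-infinite words and their factors -/

/-- The finite word `x_k x_{k+1} ⋯ x_{k+n-1}` read in the bi-infinite word `x`. -/
def window (x : ℤ → A) (k : ℤ) (n : ℕ) : List A :=
  List.ofFn fun i : Fin n => x (k + (i : ℕ))

/-- The language of `x`: the set of its (finite, possibly empty) factors. -/
def language (x : ℤ → A) : Set (List A) :=
  {w | ∃ (k : ℤ) (n : ℕ), w = window x k n}

/-- The bi-infinite word `x` is over the alphabet `A`: every letter of `A` appears in `x`. -/
def IsOver (x : ℤ → A) : Prop :=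
  ∀ a : A, ∃ n : ℤ, x n = a

/-! ### Extension graphs and dendric words -/

/-- Left extensions of `w` in `x`: the letters `a` such that `aw` is a factor of `x`. -/
def leftExt (x : ℤ → A) (w : List A) : Set A :=
  {a | a :: w ∈ language x}

/-- Right extensions of `w` in `x`: the letters `b` such that `wb` is a factor of `x`. -/
def rightExt (x : ℤ → A) (w : List A) : Set A :=
  {b | w ++ [b] ∈ language x}

/-- Bi-extensions of `w` in `x`: the pairs `(a, b)` such that `awb` is a factor of `x`. -/
def biExt (x : ℤ → A) (w : List A) : Set (A × A) :=
  {p | p.1 :: (w ++ [p.2]) ∈ language x}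

/-- The extension graph of `w` in `x`: the undirected bipartite graph on the disjoint union of
the left and of the right extensions of `w`, with an edge between the left vertex `a` and the
right vertex `b` exactly when `(a, b)` is a bi-extension of `w`. -/
def extensionGraph (x : ℤ → A) (w : List A) :
    SimpleGraph (leftExt x w ⊕ rightExt x w) where
  Adj u v :=
    (∃ (a : leftExt x w) (b : rightExt x w),
      u = Sum.inl a ∧ v = Sum.inr b ∧ ((a : A), (b : A)) ∈ biExt x w) ∨
    (∃ (a : leftExt x w) (b : rightExt x w),
      u = Sum.inr b ∧ v = Sum.inl a ∧ ((a : A), (b : A)) ∈ biExt x w)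
  symm := by
    constructor
    rintro u v (⟨a, b, h₁, h₂, h⟩ | ⟨a, b, h₁, h₂, h⟩)
    · exact Or.inr ⟨a, b, h₂, h₁, h⟩
    · exact Or.inl ⟨a, b, h₂, h₁, h⟩
  loopless := by
    constructor
    rintro u (⟨a, b, h₁, h₂, h⟩ | ⟨a, b, h₁, h₂, h⟩) <;> simp [h₁] at h₂

/-- A bi-infinite word is dendric if the extension graph of each of its factors is a tree. -/
def IsDendric (x : ℤ → A) : Prop :=
  ∀ w ∈ language x, (extensionGraph x w).IsTree

/-! ### Morphisms -/

/-- A morphism is non-erasing if the images of the letters are non-empty. -/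
def NonErasing (σ : FreeMonoid A →* FreeMonoid B) : Prop :=
  ∀ a : A, σ (FreeMonoid.of a) ≠ 1

/-- The alphabet `B` is minimal for `σ`: every letter of `B` appears in the image of some word. -/
def MinimalCodomain (σ : FreeMonoid A →* FreeMonoid B) : Prop :=
  ∀ b : B, ∃ w : FreeMonoid A, b ∈ (σ w).toList

/-- The image of a finite word under a morphism. -/
def mapWord (σ : FreeMonoid A →* FreeMonoid B) (w : List A) : List B :=
  (σ (FreeMonoid.ofList w)).toList

/-- A non-erasing morphism does not decrease the length of words. -/
theorem NonErasing.length_le {σ : FreeMonoid A →* FreeMonoid B} (hσ : NonErasing σ)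
    (w : List A) : w.length ≤ (mapWord σ w).length := by
  induction w with
  | nil => simp
  | cons a w ih =>
    have h1 : mapWord σ (a :: w) = (σ (FreeMonoid.of a)).toList ++ mapWord σ w := by
      simp [mapWord, FreeMonoid.ofList_cons]
    have h2 : 0 < (σ (FreeMonoid.of a)).toList.length :=
      List.length_pos_iff.2 fun h => hσ a (FreeMonoid.toList.injective h)
    rw [h1, List.length_append, List.length_cons]
    omega

/-- The image `σ(x) = ⋯ σ(x_{-2}) σ(x_{-1}) . σ(x_0) σ(x_1) ⋯` of a bi-infinite word under a
non-erasing morphism, where `σ(x_0)` starts at position `0`. For `m ≥ 0`, the letter at position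
`m` is the letter of index `m` (counted from `0`, from the left) of `σ(x_0 ⋯ x_m)`; the letter at
position `-(m+1)` is the letter of index `m` (counted from `0`, from the right) of
`σ(x_{-(m+1)} ⋯ x_{-1})`. -/
def wordImage (σ : FreeMonoid A →* FreeMonoid B) (hσ : NonErasing σ) (x : ℤ → A) : ℤ → B
  | Int.ofNat m =>
      (mapWord σ (window x 0 (m + 1)))[m]'(by
        have := hσ.length_le (window x 0 (m + 1))
        simp only [window, List.length_ofFn] at this ⊢
        omega)
  | Int.negSucc m =>
      (mapWord σ (window x (Int.negSucc m) (m + 1))).reverse[m]'(by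
        have := hσ.length_le (window x (Int.negSucc m) (m + 1))
        simp only [window, List.length_ofFn, List.length_reverse] at this ⊢
        omega)

/-- A non-erasing morphism `σ : A* → B*` is dendric preserving if, for every dendric bi-infinite
word `x` over `A`, the bi-infinite word `σ(x)` is dendric. -/
def DendricPreserving (σ : FreeMonoid A →* FreeMonoid B) (hσ : NonErasing σ) : Prop :=
  ∀ x : ℤ → A, IsOver x → IsDendric x → IsDendric (wordImage σ hσ x)

/-- A bijective coding: the images of the letters are single letters, and are distinct. -/
def IsBijectiveCoding (κ : FreeMonoid A →* FreeMonoid B) : Prop :=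
  (∀ a : A, (κ (FreeMonoid.of a)).length = 1) ∧
    Function.Injective fun a : A => κ (FreeMonoid.of a)

/-! ### Arnoux-Rauzy morphisms -/

open Classical in
/-- `L_ℓ : ℓ ↦ ℓ, a ↦ ℓa` for `a ≠ ℓ`. -/
noncomputable def arL (l : A) : Monoid.End (FreeMonoid A) :=
  FreeMonoid.lift fun a =>
    if a = l then FreeMonoid.of l else FreeMonoid.of l * FreeMonoid.of a

open Classical in
/-- `R_ℓ : ℓ ↦ ℓ, a ↦ aℓ` for `a ≠ ℓ`. -/
noncomputable def arR (l : A) : Monoid.End (FreeMonoid A) :=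
  FreeMonoid.lift fun a =>
    if a = l then FreeMonoid.of l else FreeMonoid.of a * FreeMonoid.of l

/-- The monoid (under composition) generated by the Arnoux-Rauzy morphisms over `A`. -/
def arMonoid (A : Type*) : Submonoid (Monoid.End (FreeMonoid A)) :=
  Submonoid.closure (Set.range arL ∪ Set.range arR)

end Dendric

/-!
The argument works with languages. The words of `σ(x)` are the factors of the images of the words
of `x` (`language_wordImage`), and `x` is dendric if and only if, for every word `w` of its
language, the relation `{(a, b) | awb is a factor}` is a tree (`isDendric_iff`). About trees, only
two facts are used to exclude morphisms: a tree contains no square (`RelTree.no_square`), and it is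
connected.

*Arnoux-Rauzy morphisms preserve dendric words.* In `L_l(x)`, each letter different from `l` is
surrounded by letters `l`. Hence the extension graph of a word is a double star, unless the word is
`L_l(u) l` for some `u`, and then it is the extension graph of the shorter word `u` in `x`
(`relTree_or_shorter`). As `R_l` is conjugate to `L_l`, it produces the same language. The same
dichotomy shows that `x` is dendric if `L_l(x)` is, and that the fixed points of suitable products
of the `L_l` are dendric (`arLang_dendric`). Inserting a new letter once in such a fixed point adds
a leaf to some extension graphs, so that it gives dendric words in which two given right (or left)
vertices of the graph of the empty word have no common neighbour (`exists_dendric_insert`).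

*Dendric preserving morphisms.* Let `f` preserve dendric words. Rotating its images to the right as
much as possible gives a conjugate `g` whose last letters `G(a)` are not all equal; rotating `g` to
the left as much as possible gives `s f₁ = g s` where the first letters `F(a)` of `f₁` are not all
equal. Both rotations stop, since otherwise the images would be periodic words, while a dendric
word has right special factors of every length. The extension graph of `s` in the image of `x`
contains the pairs `(G(a), F(b))` for all the factors `ab` of `x`. If `F` were not injective, the
words with an inserted letter would give a square in this tree; the same holds for `G`
(`injective_of_relTree`). Moreover `|B| ≤ |A|` because of the factor complexity
(`Preserving.card_le`), so `F` and `G` are bijective.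

If `s` is not empty, with last letter `l`, then `l` is followed by all the letters; likewise all the
letters are followed by the first letter of `s`. The absence of squares forces this first letter to
be `l`, and every factor of length two to contain `l`. It follows that `f = L_l ∘ f'` or
`f = R_l ∘ f'`, and `f'` is again dendric preserving. If `s` is empty, a pair of consecutive
letters inside an image `f(a)` would be an edge of all the double stars, which is impossible for
three letters or more; the remaining case of two letters is excluded by an alternation argument
(`Preserving.not_alternating`), so `f` is a bijective coding. The theorem follows by induction on
the total length of the images.
-/

namespace Dendric

variable {A B : Type*}

/-! ### Relations whose bipartite graph is a tree -/

/-- The bipartite graph on `S ⊔ T` whose edges are the pairs of `R`. -/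
def bipGraph (S T : Set A) (R : Set (A × A)) : SimpleGraph (S ⊕ T) where
  Adj u v :=
    (∃ (a : S) (b : T), u = Sum.inl a ∧ v = Sum.inr b ∧ ((a : A), (b : A)) ∈ R) ∨
    (∃ (a : S) (b : T), u = Sum.inr b ∧ v = Sum.inl a ∧ ((a : A), (b : A)) ∈ R)
  symm := by
    constructor
    rintro u v (⟨a, b, h₁, h₂, h⟩ | ⟨a, b, h₁, h₂, h⟩)
    · exact Or.inr ⟨a, b, h₂, h₁, h⟩
    · exact Or.inl ⟨a, b, h₂, h₁, h⟩
  loopless := by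
    constructor
    rintro u (⟨a, b, h₁, h₂, h⟩ | ⟨a, b, h₁, h₂, h⟩) <;> simp [h₁] at h₂

/-- The relation `R`, seen as a bipartite graph on the disjoint union of its domain and of its
range, is a tree. -/
def RelTree (R : Set (A × A)) : Prop :=
  (bipGraph (Prod.fst '' R) (Prod.snd '' R) R).IsTree

/-- Two pairs are linked if the second one is in `R` and they share a coordinate. -/
def EdgeLink (R : Set (A × A)) (p q : A × A) : Prop :=
  q ∈ R ∧ (p.1 = q.1 ∨ p.2 = q.2)

/-- The relation `R` is non-empty and connected, in terms of its pairs. -/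
def ConnRel (R : Set (A × A)) : Prop :=
  R.Nonempty ∧ ∀ p ∈ R, ∀ q ∈ R, Relation.ReflTransGen (EdgeLink R) p q

/-- The pair `p` is an edge at the vertex `v`. -/
def Incident {S T : Set A} (p : A × A) : S ⊕ T → Prop
  | Sum.inl a => p.1 = a
  | Sum.inr b => p.2 = b

theorem bipGraph_connected_iff (R : Set (A × A)) :
    (bipGraph (Prod.fst '' R) (Prod.snd '' R) R).Connected ↔ ConnRel R := by
  set G := bipGraph (Prod.fst '' R) (Prod.snd '' R) R with hG
  have hinc : ∀ v : (Prod.fst '' R : Set A) ⊕ (Prod.snd '' R : Set A),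
      ∃ p ∈ R, Incident p v := by
    rintro (⟨_, p, hp, rfl⟩ | ⟨_, p, hp, rfl⟩)
    · exact ⟨p, hp, rfl⟩
    · exact ⟨p, hp, rfl⟩
  have hshare : ∀ (v : (Prod.fst '' R : Set A) ⊕ (Prod.snd '' R : Set A)) (p q : A × A),
      Incident p v → Incident q v → q ∈ R → EdgeLink R p q := by
    rintro (a | b) p q hp hq hqR
    · exact ⟨hqR, Or.inl (hp.trans hq.symm)⟩
    · exact ⟨hqR, Or.inr (hp.trans hq.symm)⟩
  have hadj : ∀ u v, G.Adj u v → ∃ p ∈ R, Incident p u ∧ Incident p v := by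
    rintro u v (⟨a, b, rfl, rfl, h⟩ | ⟨a, b, rfl, rfl, h⟩)
    · exact ⟨_, h, rfl, rfl⟩
    · exact ⟨_, h, rfl, rfl⟩
  have hreach : ∀ u v p, p ∈ R → Incident p u → Incident p v → G.Reachable u v := by
    rintro (a | a) (b | b) p hp h1 h2
    · have : a = b := Subtype.ext (h1.symm.trans h2)
      rw [this]
    · refine SimpleGraph.Adj.reachable (Or.inl ⟨a, b, rfl, rfl, ?_⟩)
      rw [← show p.1 = a from h1, ← show p.2 = b from h2]; exact hp
    · refine SimpleGraph.Adj.reachable (Or.inr ⟨b, a, rfl, rfl, ?_⟩)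
      rw [← show p.2 = a from h1, ← show p.1 = b from h2]; exact hp
    · have : a = b := Subtype.ext (h1.symm.trans h2)
      rw [this]
  constructor
  · intro h
    refine ⟨?_, fun p hp q hq => ?_⟩
    · obtain ⟨v⟩ := h.nonempty
      obtain ⟨p, hp, -⟩ := hinc v
      exact ⟨p, hp⟩
    · have key : ∀ u v, Relation.ReflTransGen G.Adj u v → ∀ p ∈ R, Incident p u →
          ∀ q ∈ R, Incident q v → Relation.ReflTransGen (EdgeLink R) p q := by
        intro u v huv
        induction huv with
        | refl => exact fun p hp h1 q hq h2 => .single (hshare _ _ _ h1 h2 hq)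
        | tail _ hvw ih =>
          intro p hp h1 q hq h2
          obtain ⟨e, he, h3, h4⟩ := hadj _ _ hvw
          exact (ih p hp h1 e he h3).tail (hshare _ _ _ h4 h2 hq)
      have hr := h.preconnected (Sum.inl ⟨p.1, p, hp, rfl⟩) (Sum.inl ⟨q.1, q, hq, rfl⟩)
      rw [SimpleGraph.reachable_iff_reflTransGen] at hr
      exact key _ _ hr p hp rfl q hq rfl
  · rintro ⟨⟨p0, hp0⟩, h⟩
    have key : ∀ p ∈ R, ∀ q, Relation.ReflTransGen (EdgeLink R) p q → q ∈ R ∧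
        ∀ u v, Incident p u → Incident q v → G.Reachable u v := by
      intro p hp q hpq
      induction hpq with
      | refl => exact ⟨hp, fun u v h1 h2 => hreach u v p hp h1 h2⟩
      | @tail q r _ hqr ih =>
        refine ⟨hqr.1, fun u v h1 h2 => ?_⟩
        rcases hqr.2 with h3 | h3
        · exact (ih.2 u (Sum.inl ⟨q.1, q, ih.1, rfl⟩) h1 rfl).trans
            (hreach _ _ r hqr.1 h3.symm h2)
        · exact (ih.2 u (Sum.inr ⟨q.2, q, ih.1, rfl⟩) h1 rfl).trans
            (hreach _ _ r hqr.1 h3.symm h2)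
    have : Nonempty ((Prod.fst '' R : Set A) ⊕ (Prod.snd '' R : Set A)) :=
      ⟨Sum.inl ⟨p0.1, p0, hp0, rfl⟩⟩
    refine SimpleGraph.Connected.mk fun u v => ?_
    obtain ⟨p, hp, h1⟩ := hinc u
    obtain ⟨q, hq, h2⟩ := hinc v
    exact (key p hp q (h p hp q hq)).2 u v h1 h2

theorem bipGraph_card_edgeSet (R : Set (A × A)) :
    Nat.card (bipGraph (Prod.fst '' R) (Prod.snd '' R) R).edgeSet = R.ncard := by
  rw [← Nat.card_coe_set_eq]
  symm
  let f : R → (bipGraph (Prod.fst '' R) (Prod.snd '' R) R).edgeSet := fun p =>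
    ⟨s(Sum.inl ⟨p.1.1, p.1, p.2, rfl⟩, Sum.inr ⟨p.1.2, p.1, p.2, rfl⟩),
      Or.inl ⟨_, _, rfl, rfl, p.2⟩⟩
  refine Nat.card_congr (Equiv.ofBijective f ⟨?_, ?_⟩)
  · rintro ⟨⟨a, b⟩, hp⟩ ⟨⟨a', b'⟩, hq⟩ h
    have h1 : (s(Sum.inl ⟨a, _⟩, Sum.inr ⟨b, _⟩) : Sym2 ((Prod.fst '' R : Set A) ⊕
        (Prod.snd '' R : Set A))) = s(Sum.inl ⟨a', _⟩, Sum.inr ⟨b', _⟩) := congrArg Subtype.val h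
    rcases Sym2.eq_iff.1 h1 with ⟨h2, h3⟩ | ⟨h2, -⟩
    · have h4 : a = a' := congrArg Subtype.val (Sum.inl.inj h2)
      have h5 : b = b' := congrArg Subtype.val (Sum.inr.inj h3)
      subst h4 h5
      rfl
    · cases h2
  · rintro ⟨e, he⟩
    induction e using Sym2.ind with
    | _ u v =>
      rcases he with ⟨a, b, h1, h2, h⟩ | ⟨a, b, h1, h2, h⟩
      · obtain rfl : u = Sum.inl a := h1
        obtain rfl : v = Sum.inr b := h2
        exact ⟨⟨_, h⟩, rfl⟩
      · obtain rfl : u = Sum.inr b := h1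
        obtain rfl : v = Sum.inl a := h2
        exact ⟨⟨_, h⟩, Subtype.ext Sym2.eq_swap⟩

/-- A finite relation is a tree if and only if it is connected and satisfies the Euler relation. -/
theorem relTree_iff [Finite A] (R : Set (A × A)) :
    RelTree R ↔ ConnRel R ∧
      R.ncard + 1 = (Prod.fst '' R).ncard + (Prod.snd '' R).ncard := by
  rw [RelTree, SimpleGraph.isTree_iff_connected_and_card, bipGraph_connected_iff,
    bipGraph_card_edgeSet, Nat.card_sum, Nat.card_coe_set_eq, Nat.card_coe_set_eq]

theorem RelTree.connRel {R : Set (A × A)} (h : RelTree R) : ConnRel R :=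
  (bipGraph_connected_iff R).1 h.connected

/-- The bipartite graph of a tree contains no cycle of length four. -/
theorem RelTree.no_square {R : Set (A × A)} (h : RelTree R) {a a' b b' : A}
    (h1 : (a, b) ∈ R) (h2 : (a', b) ∈ R) (h3 : (a, b') ∈ R) (h4 : (a', b') ∈ R)
    (ha : a ≠ a') : b = b' := by
  by_contra hb
  set G := bipGraph (Prod.fst '' R) (Prod.snd '' R) R with hG
  let u : (Prod.fst '' R : Set A) ⊕ (Prod.snd '' R : Set A) := Sum.inl ⟨a, _, h1, rfl⟩
  let u' : (Prod.fst '' R : Set A) ⊕ (Prod.snd '' R : Set A) := Sum.inl ⟨a', _, h2, rfl⟩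
  let v : (Prod.fst '' R : Set A) ⊕ (Prod.snd '' R : Set A) := Sum.inr ⟨b, _, h1, rfl⟩
  let v' : (Prod.fst '' R : Set A) ⊕ (Prod.snd '' R : Set A) := Sum.inr ⟨b', _, h3, rfl⟩
  have huu : u ≠ u' := fun h => ha (congrArg Subtype.val (Sum.inl.inj h))
  have hvv : v ≠ v' := fun h => hb (congrArg Subtype.val (Sum.inr.inj h))
  have e1 : G.Adj u v := Or.inl ⟨_, _, rfl, rfl, h1⟩
  have e2 : G.Adj v u' := Or.inr ⟨_, _, rfl, rfl, h2⟩
  have e3 : G.Adj u v' := Or.inl ⟨_, _, rfl, rfl, h3⟩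
  have e4 : G.Adj v' u' := Or.inr ⟨_, _, rfl, rfl, h4⟩
  have p1 : (SimpleGraph.Walk.cons e1 (.cons e2 .nil)).IsPath := by
    simp [SimpleGraph.Walk.isPath_def, huu, e1.ne, e2.ne]
  have p2 : (SimpleGraph.Walk.cons e3 (.cons e4 .nil)).IsPath := by
    simp [SimpleGraph.Walk.isPath_def, huu, e3.ne, e4.ne]
  have := (h.isAcyclic.subsingleton_path u u').elim ⟨_, p1⟩ ⟨_, p2⟩
  have h5 := congrArg (fun p : G.Path u u' => p.1.support) this
  simp [hvv] at h5

/-- A double star is a tree. -/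
theorem relTree_of_doubleStar [Finite A] {R : Set (A × A)} {l l' : A} (hl : (l, l') ∈ R)
    (h : ∀ p ∈ R, p.1 = l ∨ p.2 = l') : RelTree R := by
  rw [relTree_iff]
  refine ⟨⟨⟨_, hl⟩, fun p hp q hq => ?_⟩, ?_⟩
  · have h1 : EdgeLink R p (l, l') := ⟨hl, h p hp⟩
    have h2 : EdgeLink R (l, l') q := ⟨hq, (h q hq).imp Eq.symm Eq.symm⟩
    exact (Relation.ReflTransGen.single h1).tail h2
  · have hR : R = (fun b => (l, b)) '' {b | (l, b) ∈ R} ∪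
        (fun a => (a, l')) '' {a | (a, l') ∈ R} := by
      ext ⟨a, b⟩
      constructor
      · intro hp
        rcases h _ hp with h1 | h1
        · obtain rfl : a = l := h1
          exact Or.inl ⟨b, hp, rfl⟩
        · obtain rfl : b = l' := h1
          exact Or.inr ⟨a, hp, rfl⟩
      · rintro (⟨c, hc, h1⟩ | ⟨c, hc, h1⟩)
        · rw [← h1]; exact hc
        · rw [← h1]; exact hc
    have hI : (fun b => (l, b)) '' {b | (l, b) ∈ R} ∩
        (fun a => (a, l')) '' {a | (a, l') ∈ R} = {(l, l')} := by
      ext ⟨a, b⟩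
      simp only [Set.mem_inter_iff, Set.mem_image, Set.mem_ofPred_eq, Set.mem_singleton_iff,
        Prod.mk.injEq]
      constructor
      · rintro ⟨⟨c, -, h1, -⟩, ⟨d, -, -, h2⟩⟩
        exact ⟨h1.symm, h2.symm⟩
      · rintro ⟨rfl, rfl⟩
        exact ⟨⟨_, hl, rfl, rfl⟩, ⟨_, hl, rfl, rfl⟩⟩
    have h1 : Prod.fst '' R = {a | (a, l') ∈ R} := by
      ext a
      constructor
      · rintro ⟨⟨a, b⟩, hp, rfl⟩
        rcases h _ hp with h1 | h1
        · obtain rfl : a = l := h1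
          exact hl
        · obtain rfl : b = l' := h1
          exact hp
      · exact fun ha => ⟨_, ha, rfl⟩
    have h2 : Prod.snd '' R = {b | (l, b) ∈ R} := by
      ext b
      constructor
      · rintro ⟨⟨a, b⟩, hp, rfl⟩
        rcases h _ hp with h1 | h1
        · obtain rfl : a = l := h1
          exact hp
        · obtain rfl : b = l' := h1
          exact hl
      · exact fun ha => ⟨_, ha, rfl⟩
    have h3 := Set.ncard_union_add_ncard_inter ((fun b => (l, b)) '' {b | (l, b) ∈ R})
      ((fun a => (a, l')) '' {a | (a, l') ∈ R}) (Set.toFinite _) (Set.toFinite _)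
    rw [← hR, hI, Set.ncard_singleton, Set.ncard_image_of_injective _ (Prod.mk_right_injective l),
      Set.ncard_image_of_injective _ (Prod.mk_left_injective l')] at h3
    rw [h1, h2, h3, add_comm]

theorem EdgeLink.mono {R R' : Set (A × A)} (h : R ⊆ R') {p q : A × A} (hpq : EdgeLink R p q) :
    EdgeLink R' p q :=
  ⟨h hpq.1, hpq.2⟩

/-- Adding to a connected relation a pair which shares a coordinate with one of its pairs. -/
theorem ConnRel.insert {R : Set (A × A)} (h : ConnRel R) {p q : A × A} (hq : q ∈ R)
    (hpq : p.1 = q.1 ∨ p.2 = q.2) : ConnRel (insert p R) := by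
  have hsub : R ⊆ Insert.insert p R := Set.subset_insert p R
  have h1 : EdgeLink (Insert.insert p R) p q := ⟨hsub hq, hpq⟩
  have h2 : EdgeLink (Insert.insert p R) q p :=
    ⟨Set.mem_insert p R, hpq.imp Eq.symm Eq.symm⟩
  have h3 : ∀ r ∈ R, ∀ s ∈ R, Relation.ReflTransGen (EdgeLink (Insert.insert p R)) r s :=
    fun r hr s hs => Relation.ReflTransGen.mono (fun _ _ => EdgeLink.mono hsub) _ _ (h.2 r hr s hs)
  refine ⟨⟨p, Set.mem_insert p R⟩, ?_⟩
  rintro r (rfl | hr) s (rfl | hs)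
  · exact .refl
  · exact (Relation.ReflTransGen.single h1).trans (h3 _ hq _ hs)
  · exact (h3 _ hr _ hq).tail h2
  · exact h3 _ hr _ hs

theorem RelTree.insert_right [Finite A] {R : Set (A × A)} (h : RelTree R) {a b b' : A}
    (ha : (a, b') ∈ R) (hb : b ∉ Prod.snd '' R) : RelTree (insert (a, b) R) := by
  rw [relTree_iff] at h ⊢
  refine ⟨h.1.insert ha (Or.inl rfl), ?_⟩
  have hab : (a, b) ∉ R := fun hp => hb ⟨_, hp, rfl⟩
  have h1 : Set.insert a (Prod.fst '' R) = Prod.fst '' R := Set.insert_eq_of_mem ⟨_, ha, rfl⟩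
  rw [Set.image_insert_eq, Set.image_insert_eq, Set.ncard_insert_of_notMem hab,
    Set.ncard_insert_of_notMem hb]
  change _ = (Set.insert a (Prod.fst '' R)).ncard + _
  rw [h1, h.2, add_assoc]

theorem RelTree.insert_left [Finite A] {R : Set (A × A)} (h : RelTree R) {a b a' : A}
    (ha : (a', b) ∈ R) (hb : a ∉ Prod.fst '' R) : RelTree (insert (a, b) R) := by
  rw [relTree_iff] at h ⊢
  refine ⟨h.1.insert ha (Or.inr rfl), ?_⟩
  have hab : (a, b) ∉ R := fun hp => hb ⟨_, hp, rfl⟩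
  have h1 : Set.insert b (Prod.snd '' R) = Prod.snd '' R := Set.insert_eq_of_mem ⟨_, ha, rfl⟩
  rw [Set.image_insert_eq, Set.image_insert_eq, Set.ncard_insert_of_notMem hab,
    Set.ncard_insert_of_notMem hb]
  change _ = _ + (Set.insert b (Prod.snd '' R)).ncard
  rw [h1, h.2, add_right_comm]

theorem RelTree.image [Finite A] [Finite B] {R : Set (A × A)} (h : RelTree R) {e : A → B}
    (he : Function.Injective e) : RelTree (Prod.map e e '' R) := by
  rw [relTree_iff] at h ⊢
  refine ⟨⟨h.1.1.image _, ?_⟩, ?_⟩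
  · rintro _ ⟨p, hp, rfl⟩ _ ⟨q, hq, rfl⟩
    refine Relation.ReflTransGen.lift (Prod.map e e) ?_ _ _ (h.1.2 p hp q hq)
    exact fun r s hrs => ⟨⟨s, hrs.1, rfl⟩, hrs.2.imp (congrArg e) (congrArg e)⟩
  · rw [Set.ncard_image_of_injective _ (he.prodMap he)]
    have h1 : Prod.fst '' (Prod.map e e '' R) = e '' (Prod.fst '' R) := by
      simp [Set.image_image]
    have h2 : Prod.snd '' (Prod.map e e '' R) = e '' (Prod.snd '' R) := by
      simp [Set.image_image]
    rw [h1, h2, Set.ncard_image_of_injective _ he, Set.ncard_image_of_injective _ he, h.2]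

/-- In a connected relation, two elements of the range are joined by a chain in which consecutive
elements have a common left neighbour. -/
theorem ConnRel.right_chain {R : Set (A × A)} (h : ConnRel R) {b b' : A}
    (hb : b ∈ Prod.snd '' R) (hb' : b' ∈ Prod.snd '' R) :
    Relation.ReflTransGen (fun c d => ∃ a, (a, c) ∈ R ∧ (a, d) ∈ R) b b' := by
  obtain ⟨p, hp, rfl⟩ := hb
  obtain ⟨q, hq, rfl⟩ := hb'
  suffices H : ∀ q, Relation.ReflTransGen (EdgeLink R) p q → q ∈ R ∧
      Relation.ReflTransGen (fun c d => ∃ a, (a, c) ∈ R ∧ (a, d) ∈ R) p.2 q.2 from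
    (H q (h.2 p hp q hq)).2
  intro q hpq
  induction hpq with
  | refl => exact ⟨hp, .refl⟩
  | @tail q r _ hqr ih =>
    refine ⟨hqr.1, ?_⟩
    rcases hqr.2 with h3 | h3
    · exact ih.2.tail ⟨q.1, ih.1, by rw [h3]; exact hqr.1⟩
    · rw [← h3]; exact ih.2

/-! ### Languages -/

/-- A set of words is treated as the language of a bi-infinite word would be: it contains the
empty word, it is closed under factors, and its words can be extended on both sides. -/
structure IsLang (K : Set (List A)) : Prop where
  nil_mem : [] ∈ K
  factor : ∀ {u v : List A}, u <:+: v → v ∈ K → u ∈ K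
  extend : ∀ w ∈ K, ∃ a b, a :: (w ++ [b]) ∈ K

/-- The pairs `(a, b)` such that `awb` is in `K`. -/
def biE (K : Set (List A)) (w : List A) : Set (A × A) :=
  {p | p.1 :: (w ++ [p.2]) ∈ K}

/-- The extension graphs of all the words of `K` are trees. -/
def DendricL (K : Set (List A)) : Prop :=
  ∀ w ∈ K, RelTree (biE K w)

/-- The factors of the images of the words of `K` under the morphism `a ↦ h a`. -/
def Lang (h : A → List B) (K : Set (List A)) : Set (List B) :=
  {w | ∃ u ∈ K, w <:+: u.flatMap h}

@[simp] theorem mem_biE {K : Set (List A)} {w : List A} {a b : A} :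
    (a, b) ∈ biE K w ↔ a :: (w ++ [b]) ∈ K := Iff.rfl

/-! ### Windows -/

@[simp] theorem window_length (x : ℤ → A) (k : ℤ) (n : ℕ) : (window x k n).length = n := by
  simp [window]

@[simp] theorem window_getElem (x : ℤ → A) (k : ℤ) (n i : ℕ) (h : i < (window x k n).length) :
    (window x k n)[i] = x (k + i) := by
  simp [window]

theorem window_add (x : ℤ → A) (k : ℤ) (m n : ℕ) :
    window x k (m + n) = window x k m ++ window x (k + m) n := by
  refine List.ext_getElem (by simp) fun i h1 h2 => ?_
  rw [window_getElem, List.getElem_append]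
  split_ifs with h
  · rw [window_getElem]
  · rw [window_getElem]
    rw [window_length] at h ⊢
    congr 1
    push_cast [not_lt.1 h]
    ring

@[simp] theorem window_zero (x : ℤ → A) (k : ℤ) : window x k 0 = [] := by simp [window]

@[simp] theorem window_one (x : ℤ → A) (k : ℤ) : window x k 1 = [x k] := by simp [window]

theorem window_succ (x : ℤ → A) (k : ℤ) (n : ℕ) :
    window x k (n + 1) = window x k n ++ [x (k + n)] := by
  rw [window_add, window_one]

theorem window_succ' (x : ℤ → A) (k : ℤ) (n : ℕ) :
    window x k (n + 1) = x k :: window x (k + 1) n := by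
  rw [add_comm, window_add, window_one]; rfl

theorem eq_window_iff {x : ℤ → A} {k : ℤ} {w : List A} :
    w = window x k w.length ↔ ∀ (i : ℕ) (h : i < w.length), w[i] = x (k + i) := by
  constructor
  · intro h i hi
    conv_lhs => rw [List.getElem_of_eq h]
    rw [window_getElem]
  · intro h
    refine List.ext_getElem (by simp) fun i h1 h2 => ?_
    rw [window_getElem, h]

/-- The parts of a decomposition of a window are windows. -/
theorem window_eq_append {x : ℤ → A} {k : ℤ} {n : ℕ} {u v : List A}
    (h : window x k n = u ++ v) :
    u = window x k u.length ∧ v = window x (k + u.length) v.length := by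
  have hn : n = u.length + v.length := by
    have := congrArg List.length h
    simpa using this
  rw [hn, window_add] at h
  obtain ⟨h1, h2⟩ := List.append_inj h (by simp)
  exact ⟨h1.symm, h2.symm⟩

theorem window_infix {x : ℤ → A} {k l : ℤ} {m n : ℕ} (h1 : l ≤ k) (h2 : k + m ≤ l + n) :
    window x k m <:+: window x l n := by
  obtain ⟨i, hi⟩ := Int.le.dest h1
  obtain ⟨j, hj⟩ := Int.le.dest h2
  have hn : n = i + m + j := by omega
  refine ⟨window x l i, window x (k + m) j, ?_⟩
  rw [hn, window_add, window_add, hi, ← hi]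
  push_cast
  rw [add_assoc]

theorem infix_window {x : ℤ → A} {k : ℤ} {n : ℕ} {u : List A} (h : u <:+: window x k n) :
    ∃ l, k ≤ l ∧ u = window x l u.length := by
  obtain ⟨s, t, hst⟩ := h
  have h1 := (window_eq_append hst.symm).1
  have h2 := (window_eq_append h1.symm).2
  exact ⟨_, by omega, h2⟩

theorem window_mem_language (x : ℤ → A) (k : ℤ) (n : ℕ) : window x k n ∈ language x :=
  ⟨k, n, rfl⟩

theorem mem_language_iff {x : ℤ → A} {w : List A} :
    w ∈ language x ↔ ∃ k, w = window x k w.length := by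
  constructor
  · rintro ⟨k, n, rfl⟩
    exact ⟨k, by simp⟩
  · rintro ⟨k, h⟩
    exact ⟨k, _, h⟩

theorem language_isLang (x : ℤ → A) : IsLang (language x) where
  nil_mem := ⟨0, 0, by simp⟩
  factor := by
    rintro u v huv ⟨k, n, rfl⟩
    obtain ⟨l, -, hl⟩ := infix_window huv
    exact ⟨l, _, hl⟩
  extend := by
    rintro _ ⟨k, n, rfl⟩
    refine ⟨x (k - 1), x (k + n), k - 1, n + 1 + 1, ?_⟩
    rw [window_succ', window_succ]
    simp

theorem extensionGraph_eq (x : ℤ → A) (w : List A) :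
    extensionGraph x w = bipGraph (leftExt x w) (rightExt x w) (biE (language x) w) := rfl

theorem IsLang.append_singleton {K : Set (List A)} (hK : IsLang K) {w : List A} (hw : w ∈ K) :
    ∃ b, w ++ [b] ∈ K := by
  obtain ⟨a, b, h⟩ := hK.extend w hw
  exact ⟨b, hK.factor ⟨[a], [], by simp⟩ h⟩

theorem IsLang.cons {K : Set (List A)} (hK : IsLang K) {w : List A} (hw : w ∈ K) :
    ∃ a, a :: w ∈ K := by
  obtain ⟨a, b, h⟩ := hK.extend w hw
  exact ⟨a, hK.factor ⟨[], [b], by simp⟩ h⟩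

theorem IsLang.biE_nonempty {K : Set (List A)} (hK : IsLang K) {w : List A} (hw : w ∈ K) :
    (biE K w).Nonempty := by
  obtain ⟨a, b, h⟩ := hK.extend w hw
  exact ⟨(a, b), h⟩

theorem IsLang.fst_image_biE {K : Set (List A)} (hK : IsLang K) (w : List A) :
    Prod.fst '' biE K w = {a | a :: w ∈ K} := by
  ext a
  constructor
  · rintro ⟨⟨a, b⟩, h, rfl⟩
    exact hK.factor ⟨[], [b], by simp⟩ h
  · intro h
    obtain ⟨b, hb⟩ := hK.append_singleton h
    exact ⟨(a, b), hb, rfl⟩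

theorem IsLang.snd_image_biE {K : Set (List A)} (hK : IsLang K) (w : List A) :
    Prod.snd '' biE K w = {b | w ++ [b] ∈ K} := by
  ext b
  constructor
  · rintro ⟨⟨a, b⟩, h, rfl⟩
    exact hK.factor ⟨[a], [], by simp⟩ h
  · intro h
    obtain ⟨a, ha⟩ := hK.cons h
    exact ⟨(a, b), ha, rfl⟩

theorem isDendric_iff (x : ℤ → A) : IsDendric x ↔ DendricL (language x) := by
  have hL := language_isLang x
  refine forall₂_congr fun w _ => ?_
  have h1 : leftExt x w = Prod.fst '' biE (language x) w := (hL.fst_image_biE w).symm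
  have h2 : rightExt x w = Prod.snd '' biE (language x) w := (hL.snd_image_biE w).symm
  rw [extensionGraph_eq, RelTree, h1, h2]

theorem IsLang.extend_left {K : Set (List A)} (hK : IsLang K) {w : List A} (hw : w ∈ K)
    (n : ℕ) : ∃ u, u.length = n ∧ u ++ w ∈ K := by
  induction n with
  | zero => exact ⟨[], rfl, hw⟩
  | succ n ih =>
    obtain ⟨u, hu, huw⟩ := ih
    obtain ⟨a, ha⟩ := hK.cons huw
    exact ⟨a :: u, by simp [hu], ha⟩

theorem IsLang.extend_right {K : Set (List A)} (hK : IsLang K) {w : List A} (hw : w ∈ K)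
    (n : ℕ) : ∃ v, v.length = n ∧ w ++ v ∈ K := by
  induction n with
  | zero => exact ⟨[], rfl, by simpa using hw⟩
  | succ n ih =>
    obtain ⟨v, hv, hwv⟩ := ih
    obtain ⟨b, hb⟩ := hK.append_singleton hwv
    exact ⟨v ++ [b], by simp [hv], by simpa using hb⟩

/-- The language of `y` is given by windows `[-p n, |W n| - p n)` which exhaust `ℤ`. -/
theorem language_eq_of_windows {y : ℤ → A} {W : ℕ → List A} {p : ℕ → ℕ}
    (hW : ∀ n, W n = window y (-p n) (W n).length) (hp : ∀ n, n ≤ p n)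
    (hq : ∀ n, p n + n ≤ (W n).length) : language y = {w | ∃ n, w <:+: W n} := by
  ext w
  constructor
  · rintro ⟨k, n, rfl⟩
    refine ⟨k.natAbs + n, ?_⟩
    have h1 := hp (k.natAbs + n)
    have h2 := hq (k.natAbs + n)
    rw [hW]
    apply window_infix <;> omega
  · rintro ⟨n, h⟩
    rw [hW] at h
    exact (language_isLang y).factor h (window_mem_language _ _ _)

/-! ### Images of languages -/

theorem infix_flatMap {u v : List A} (h : u <:+: v) (f : A → List B) :
    u.flatMap f <:+: v.flatMap f := by
  obtain ⟨s, t, rfl⟩ := h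
  exact ⟨s.flatMap f, t.flatMap f, by simp⟩

theorem length_le_flatMap {f : A → List B} (hf : ∀ a, f a ≠ []) (w : List A) :
    w.length ≤ (w.flatMap f).length := by
  induction w with
  | nil => simp
  | cons a w ih =>
    have := List.length_pos_iff.2 (hf a)
    simp only [List.flatMap_cons, List.length_append, List.length_cons]
    omega

theorem flatMap_mem_Lang {f : A → List B} {K : Set (List A)} {u : List A} (hu : u ∈ K) :
    u.flatMap f ∈ Lang f K :=
  ⟨u, hu, List.infix_refl _⟩

theorem Lang_factor {f : A → List B} {K : Set (List A)} {u v : List B} (h : u <:+: v)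
    (hv : v ∈ Lang f K) : u ∈ Lang f K := by
  obtain ⟨w, hw, h1⟩ := hv
  exact ⟨w, hw, h.trans h1⟩

theorem Lang_isLang {f : A → List B} (hf : ∀ a, f a ≠ []) {K : Set (List A)} (hK : IsLang K) :
    IsLang (Lang f K) where
  nil_mem := ⟨[], hK.nil_mem, List.infix_refl _⟩
  factor := Lang_factor
  extend := by
    rintro w ⟨u, hu, s, t, hst⟩
    obtain ⟨a, b, hab⟩ := hK.extend u hu
    obtain ⟨s0, a', hs⟩ := List.eq_nil_or_concat' (f a ++ s) |>.resolve_left (by simp [hf a])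
    obtain ⟨b', t0, ht⟩ := List.exists_cons_of_ne_nil (l := t ++ f b) (by simp [hf b])
    refine ⟨a', b', _, hab, s0, t0, ?_⟩
    simp only [List.flatMap_cons, List.flatMap_append, List.flatMap_nil, List.append_nil]
    rw [← hst]
    have : f a ++ (s ++ w ++ t ++ f b) = (f a ++ s) ++ w ++ (t ++ f b) := by simp
    rw [this, hs, ht]
    simp

theorem Lang_comp {C : Type*} (f : A → List B) (g : B → List C) (K : Set (List A)) :
    Lang (fun a => (f a).flatMap g) K = Lang g (Lang f K) := by
  ext w
  constructor
  · rintro ⟨u, hu, h⟩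
    exact ⟨u.flatMap f, flatMap_mem_Lang hu, by rwa [List.flatMap_assoc]⟩
  · rintro ⟨v, ⟨u, hu, h1⟩, h2⟩
    refine ⟨u, hu, h2.trans ?_⟩
    rw [← List.flatMap_assoc]
    exact infix_flatMap h1 g

/-- The image of a letter, as a list. -/
def letterImage (σ : FreeMonoid A →* FreeMonoid B) (a : A) : List B :=
  (σ (FreeMonoid.of a)).toList

theorem mapWord_eq_flatMap (σ : FreeMonoid A →* FreeMonoid B) (w : List A) :
    mapWord σ w = w.flatMap (letterImage σ) := by
  induction w with
  | nil => simp [mapWord]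
  | cons a w ih =>
    rw [List.flatMap_cons, ← ih]
    simp [mapWord, FreeMonoid.ofList_cons, letterImage]

theorem NonErasing.letterImage_ne {σ : FreeMonoid A →* FreeMonoid B} (hσ : NonErasing σ)
    (a : A) : letterImage σ a ≠ [] :=
  fun h => hσ a (FreeMonoid.toList.injective h)

/-- The halves of `σ(x)` are read in the images `U n` and `V n` of the windows `[-n, 0)` and
`[0, n)` of `x`. -/
theorem language_wordImage (σ : FreeMonoid A →* FreeMonoid B) (hσ : NonErasing σ) (x : ℤ → A) :
    language (wordImage σ hσ x) = Lang (letterImage σ) (language x) := by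
  set f := letterImage σ with hf
  have hne : ∀ a, f a ≠ [] := hσ.letterImage_ne
  set y := wordImage σ hσ x with hy
  let U : ℕ → List B := fun n => (window x (-n) n).flatMap f
  let V : ℕ → List B := fun n => (window x 0 n).flatMap f
  have hU : ∀ n, U n = window y (-((U n).length : ℕ)) (U n).length := by
    intro n
    rw [eq_window_iff]
    intro i hi
    obtain ⟨m, hm⟩ : ∃ m : ℕ, (U n).length = i + (m + 1) := ⟨(U n).length - i - 1, by omega⟩
    have h1 : (-((U n).length : ℕ) : ℤ) + i = Int.negSucc m := by
      rw [hm, Int.negSucc_eq]; push_cast; ring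
    have hlen := length_le_flatMap hne (window x (Int.negSucc m) (m + 1))
    rw [window_length] at hlen
    rw [h1]
    have h2 : y (Int.negSucc m) =
        ((window x (Int.negSucc m) (m + 1)).flatMap f).reverse[m]'(by simpa using hlen) := by
      simp only [hy, wordImage, mapWord_eq_flatMap, hf]
    rw [h2]
    have h3 : (U n)[i] = (U n).reverse[m]'(by simp; omega) := by
      rw [List.getElem_reverse]
      congr 1
      omega
    rw [h3]
    have hneg : (Int.negSucc m : ℤ) = -((m + 1 : ℕ) : ℤ) := by simp [Int.negSucc_eq]
    have key : ∀ a b : ℕ, a ≤ b → U a <:+ U b := by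
      intro a b hab
      obtain ⟨c, rfl⟩ := Nat.exists_eq_add_of_le' hab
      simp only [U]
      rw [window_add, List.flatMap_append]
      have : (-((c + a : ℕ) : ℤ)) + (c : ℕ) = -(a : ℕ) := by push_cast; ring
      rw [this]
      exact ⟨_, rfl⟩
    have hUm : ((window x (Int.negSucc m) (m + 1)).flatMap f) = U (m + 1) := by
      simp only [U]; rw [hneg]
    simp only [hUm]
    rcases le_total n (m + 1) with h | h
    · exact (List.reverse_prefix.2 (key _ _ h)).getElem _
    · exact ((List.reverse_prefix.2 (key _ _ h)).getElem _).symm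
  have hV : ∀ n, V n = window y 0 (V n).length := by
    intro n
    rw [eq_window_iff]
    intro i hi
    have hlen := length_le_flatMap hne (window x 0 (i + 1))
    rw [window_length] at hlen
    rw [zero_add]
    have h2 : y (i : ℤ) = (V (i + 1))[i]'hlen := by
      change wordImage σ hσ x (Int.ofNat i) = _
      simp only [wordImage, mapWord_eq_flatMap, hf, V]
    rw [h2]
    have key : ∀ a b : ℕ, a ≤ b → V a <+: V b := by
      intro a b hab
      obtain ⟨c, rfl⟩ := Nat.exists_eq_add_of_le hab
      simp only [V]
      rw [window_add, List.flatMap_append]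
      exact ⟨_, rfl⟩
    rcases le_total n (i + 1) with h | h
    · exact (key _ _ h).getElem _
    · exact ((key _ _ h).getElem _).symm
  have hUV : ∀ n : ℕ, (window x (-n) (n + n)).flatMap f = U n ++ V n := by
    intro n
    rw [window_add, List.flatMap_append]
    simp [U, V]
  have hUl : ∀ n, n ≤ (U n).length := fun n =>
    (window_length x (-n) n).symm.le.trans (length_le_flatMap hne _)
  have hVl : ∀ n, n ≤ (V n).length := fun n =>
    (window_length x 0 n).symm.le.trans (length_le_flatMap hne _)
  have hW : ∀ n, U n ++ V n = window y (-((U n).length : ℕ)) (U n ++ V n).length := by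
    intro n
    have h1 := hU n
    have h2 := hV n
    rw [List.length_append, window_add, neg_add_cancel, ← h1, ← h2]
  have hq : ∀ n, (U n).length + n ≤ (U n ++ V n).length := by
    intro n
    rw [List.length_append]
    exact Nat.add_le_add_left (hVl n) _
  rw [language_eq_of_windows hW hUl hq]
  ext w
  constructor
  · rintro ⟨n, h⟩
    exact ⟨_, window_mem_language x (-n) (n + n), by rwa [hUV]⟩
  · rintro ⟨_, ⟨k, n, rfl⟩, h⟩
    refine ⟨k.natAbs + n, ?_⟩
    rw [← hUV]
    refine h.trans (infix_flatMap ?_ f)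
    apply window_infix <;> omega

/-! ### Conjugate morphisms -/

/-- `f` and `g` are conjugate through the word `s`: `s f(a) = g(a) s` for every letter `a`. -/
def ConjBy (s : List B) (f g : A → List B) : Prop :=
  ∀ a, s ++ f a = g a ++ s

theorem ConjBy.flatMap {s : List B} {f g : A → List B} (h : ConjBy s f g) (w : List A) :
    s ++ w.flatMap f = w.flatMap g ++ s := by
  induction w with
  | nil => simp
  | cons a w ih =>
    rw [List.flatMap_cons, List.flatMap_cons, ← List.append_assoc, h a, List.append_assoc, ih,
      List.append_assoc]

theorem ConjBy.length_eq {s : List B} {f g : A → List B} (h : ConjBy s f g) (a : A) :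
    (f a).length = (g a).length := by
  have := congrArg List.length (h a)
  simp only [List.length_append] at this
  omega

theorem ConjBy.ne_nil {s : List B} {f g : A → List B} (h : ConjBy s f g)
    (hf : ∀ a, f a ≠ []) (a : A) : g a ≠ [] := by
  rw [← List.length_pos_iff, ← h.length_eq]
  exact List.length_pos_iff.2 (hf a)

theorem ConjBy.ne_nil' {s : List B} {f g : A → List B} (h : ConjBy s f g)
    (hg : ∀ a, g a ≠ []) (a : A) : f a ≠ [] := by
  rw [← List.length_pos_iff, h.length_eq]
  exact List.length_pos_iff.2 (hg a)

theorem ConjBy.suffix {s : List B} {f g : A → List B} (h : ConjBy s f g) {w : List A}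
    (hw : s.length ≤ (w.flatMap f).length) : s <:+ w.flatMap f := by
  refine List.suffix_of_suffix_length_le ⟨_, (h.flatMap w).symm⟩ ⟨s, rfl⟩ hw

theorem ConjBy.prefix {s : List B} {f g : A → List B} (h : ConjBy s f g) {w : List A}
    (hw : s.length ≤ (w.flatMap g).length) : s <+: w.flatMap g := by
  refine List.prefix_of_prefix_length_le ⟨_, h.flatMap w⟩ ⟨s, rfl⟩ hw

/-- The conjugating word can be read in front of the image of any word. -/
theorem ConjBy.append_mem {s : List B} {f g : A → List B} (h : ConjBy s f g)
    (hf : ∀ a, f a ≠ []) {K : Set (List A)} (hK : IsLang K) {w : List A} (hw : w ∈ K) :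
    s ++ w.flatMap f ∈ Lang f K := by
  obtain ⟨u, hu, huw⟩ := hK.extend_left hw s.length
  obtain ⟨r, hr⟩ := h.suffix (hu ▸ length_le_flatMap hf u)
  refine ⟨_, huw, r, [], ?_⟩
  rw [List.flatMap_append, ← hr]
  simp

theorem ConjBy.append_mem' {s : List B} {f g : A → List B} (h : ConjBy s f g)
    (hg : ∀ a, g a ≠ []) {K : Set (List A)} (hK : IsLang K) {w : List A} (hw : w ∈ K) :
    w.flatMap g ++ s ∈ Lang g K := by
  obtain ⟨u, hu, huw⟩ := hK.extend_right hw s.length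
  obtain ⟨r, hr⟩ := h.prefix (hu ▸ length_le_flatMap hg u)
  refine ⟨_, huw, [], r, ?_⟩
  rw [List.flatMap_append, ← hr]
  simp

theorem ConjBy.Lang_eq {s : List B} {f g : A → List B} (h : ConjBy s f g)
    (hf : ∀ a, f a ≠ []) {K : Set (List A)} (hK : IsLang K) : Lang f K = Lang g K := by
  ext w
  constructor
  · rintro ⟨u, hu, hw⟩
    refine Lang_factor (hw.trans ?_) (h.append_mem' (h.ne_nil hf) hK hu)
    rw [← h.flatMap]
    exact List.infix_append' s _ [] |>.trans (by simp)
  · rintro ⟨u, hu, hw⟩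
    refine Lang_factor (hw.trans ?_) (h.append_mem hf hK hu)
    rw [h.flatMap]
    exact ⟨[], s, by simp⟩

/-! ### Arnoux-Rauzy morphisms -/

open Classical in
/-- The images of the letters under `L_l`. -/
noncomputable def lMap (l a : A) : List A := if a = l then [l] else [l, a]

open Classical in
/-- The images of the letters under `R_l`. -/
noncomputable def rMap (l a : A) : List A := if a = l then [l] else [a, l]

@[simp] theorem lMap_self (l : A) : lMap l l = [l] := by simp [lMap]

theorem lMap_of_ne {l a : A} (h : a ≠ l) : lMap l a = [l, a] := by simp [lMap, h]

theorem lMap_ne_nil (l a : A) : lMap l a ≠ [] := by unfold lMap; split_ifs <;> simp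

theorem rMap_ne_nil (l a : A) : rMap l a ≠ [] := by unfold rMap; split_ifs <;> simp

theorem conjBy_rMap_lMap (l : A) : ConjBy [l] (rMap l) (lMap l) := by
  intro a
  unfold rMap lMap
  split_ifs <;> simp

theorem lMap_eq_append (l a : A) : ∃ s, lMap l a = s ++ [a] := by
  by_cases h : a = l
  · exact ⟨[], by simp [h]⟩
  · exact ⟨[l], by simp [lMap_of_ne h]⟩

theorem lMap_eq_cons (l a : A) : ∃ t, lMap l a = l :: t := by
  by_cases h : a = l
  · exact ⟨[], by simp [h]⟩
  · exact ⟨[a], by simp [lMap_of_ne h]⟩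

theorem head_flatMap_lMap {l b : A} {u q : List A} (h : b :: q = u.flatMap (lMap l)) : b = l := by
  cases u with
  | nil => simp at h
  | cons a u =>
    obtain ⟨t, ht⟩ := lMap_eq_cons l a
    rw [List.flatMap_cons, ht] at h
    exact (List.cons.inj h).1

/-- Every occurrence of `l` in a word of the form `L_l(u)` starts the image of a letter. -/
theorem decode_lMap {l : A} {u p r : List A} (h : p ++ l :: r = u.flatMap (lMap l)) :
    ∃ u₁ u₂, u = u₁ ++ u₂ ∧ p = u₁.flatMap (lMap l) ∧ l :: r = u₂.flatMap (lMap l) := by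
  induction u generalizing p with
  | nil => simp at h
  | cons a u ih =>
    cases p with
    | nil => exact ⟨[], a :: u, rfl, rfl, h⟩
    | cons c p =>
      obtain rfl : c = l := head_flatMap_lMap (u := a :: u) (q := p ++ l :: r) h
      by_cases ha : a = c
      · subst ha
        simp only [List.flatMap_cons, lMap_self, List.cons_append, List.nil_append,
          List.cons.injEq, true_and] at h
        obtain ⟨u₁, u₂, h1, h2, h3⟩ := ih h
        exact ⟨a :: u₁, u₂, by simp [h1], by simp [h2], h3⟩
      · simp only [List.flatMap_cons, lMap_of_ne ha, List.cons_append, List.nil_append,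
          List.cons.injEq, true_and] at h
        cases p with
        | nil => exact absurd (List.cons.inj h).1.symm ha
        | cons d p =>
          simp only [List.cons_append, List.cons.injEq] at h
          obtain ⟨u₁, u₂, h1, h2, h3⟩ := ih h.2
          exact ⟨a :: u₁, u₂, by simp [h1], by simp [h2, lMap_of_ne ha, h.1], h3⟩

theorem consecutive_flatMap_lMap {l p q : A} {u s t : List A}
    (h : s ++ p :: q :: t = u.flatMap (lMap l)) : p = l ∨ q = l := by
  induction u generalizing s with
  | nil => simp at h
  | cons a u ih =>
    by_cases ha : a = l
    · subst ha
      rw [List.flatMap_cons, lMap_self] at h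
      cases s with
      | nil => exact Or.inl (List.cons.inj h).1
      | cons c s => exact ih (List.cons.inj h).2
    · rw [List.flatMap_cons, lMap_of_ne ha] at h
      match s with
      | [] => exact Or.inl (List.cons.inj h).1
      | [c] => exact Or.inr (head_flatMap_lMap (List.cons.inj (List.cons.inj h).2).2)
      | c :: d :: s => exact ih (List.cons.inj (List.cons.inj h).2).2

theorem first_of_flatMap_lMap {l b : A} {u q : List A} (h : l :: b :: q = u.flatMap (lMap l)) :
    ∃ u', u = b :: u' := by
  cases u with
  | nil => simp at h
  | cons a u =>
    refine ⟨u, ?_⟩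
    by_cases ha : a = l
    · subst ha
      rw [List.flatMap_cons, lMap_self] at h
      rw [head_flatMap_lMap (List.cons.inj h).2]
    · rw [List.flatMap_cons, lMap_of_ne ha] at h
      rw [(List.cons.inj (List.cons.inj h).2).1]

theorem last_of_flatMap_lMap {l a : A} {u p : List A} (h : p ++ [a] = u.flatMap (lMap l)) :
    ∃ u', u = u' ++ [a] := by
  rcases List.eq_nil_or_concat' u with rfl | ⟨u', b, rfl⟩
  · simp at h
  · refine ⟨u', ?_⟩
    obtain ⟨s, hs⟩ := lMap_eq_append l b
    have h1 : p ++ [a] = (u'.flatMap (lMap l) ++ s) ++ [b] := by simp [h, hs]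
    have := (List.append_inj' h1 rfl).2
    simp only [List.cons.injEq, and_true] at this
    rw [this]

theorem flatMap_lMap_injective {l : A} {u v : List A}
    (h : u.flatMap (lMap l) = v.flatMap (lMap l)) : u = v := by
  induction u generalizing v with
  | nil =>
    cases v with
    | nil => rfl
    | cons b v =>
      obtain ⟨t, ht⟩ := lMap_eq_cons l b
      simp [ht] at h
  | cons a u ih =>
    have hv : ∃ v', v = a :: v' := by
      -- a sentinel `l` makes the letter after the initial `l` always available
      have h1 : (a :: u ++ [l]).flatMap (lMap l) = (v ++ [l]).flatMap (lMap l) := by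
        simp only [List.flatMap_append, h]
      obtain ⟨b, q, hbq⟩ : ∃ b q, (a :: u ++ [l]).flatMap (lMap l) = l :: b :: q := by
        by_cases ha : a = l
        · subst ha
          cases u with
          | nil => exact ⟨a, [], by simp⟩
          | cons c u =>
            obtain ⟨t, ht⟩ := lMap_eq_cons a c
            exact ⟨a, _, by simp [ht]; rfl⟩
        · exact ⟨a, _, by simp [lMap_of_ne ha]; rfl⟩
      obtain ⟨u', hu'⟩ := first_of_flatMap_lMap hbq.symm
      obtain ⟨v', hv'⟩ := first_of_flatMap_lMap (hbq.symm.trans h1)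
      have hab : a = b := (List.cons.inj hu').1
      cases v with
      | nil =>
        obtain ⟨t, ht⟩ := lMap_eq_cons l a
        simp [ht] at h
      | cons c v => exact ⟨v, by rw [hab, (List.cons.inj hv').1]⟩
    obtain ⟨v', rfl⟩ := hv
    rw [List.flatMap_cons, List.flatMap_cons] at h
    rw [ih (List.append_cancel_left h)]

/-- Right after `L_l(w) l`, the letter read in `L_l(x)` is the letter following `w` in `x`, also
when this letter is `l`. -/
theorem biE_Lang_lMap {K : Set (List A)} (hK : IsLang K) (l : A) (w : List A) :
    biE (Lang (lMap l) K) (w.flatMap (lMap l) ++ [l]) = biE K w := by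
  ext ⟨a, b⟩
  constructor
  · rintro ⟨u, hu, s, t, h⟩
    cases w with
    | nil =>
      have h1 : (s ++ [a]) ++ l :: (b :: t) = u.flatMap (lMap l) := by rw [← h]; simp
      obtain ⟨u₁, u₂, rfl, h2, h3⟩ := decode_lMap h1
      obtain ⟨u₁', rfl⟩ := last_of_flatMap_lMap h2
      obtain ⟨u₂', rfl⟩ := first_of_flatMap_lMap h3
      exact hK.factor ⟨u₁', u₂', by simp⟩ hu
    | cons c w =>
      obtain ⟨r, hr⟩ := lMap_eq_cons l c
      have h1 : (s ++ [a]) ++ l :: (r ++ (w.flatMap (lMap l) ++ l :: (b :: t))) =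
          u.flatMap (lMap l) := by rw [← h]; simp [hr]
      obtain ⟨u₁, u₂, rfl, h2, h3⟩ := decode_lMap h1
      have h4 : (c :: w).flatMap (lMap l) ++ l :: (b :: t) = u₂.flatMap (lMap l) := by
        rw [← h3]; simp [hr]
      obtain ⟨u₃, u₄, rfl, h5, h6⟩ := decode_lMap h4
      obtain ⟨u₁', rfl⟩ := last_of_flatMap_lMap h2
      obtain ⟨u₄', rfl⟩ := first_of_flatMap_lMap h6
      rw [← flatMap_lMap_injective h5] at hu
      exact hK.factor ⟨u₁', u₄', by simp⟩ hu
  · intro h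
    obtain ⟨c, hc⟩ := hK.append_singleton (show a :: (w ++ [b]) ∈ K from h)
    obtain ⟨s, hs⟩ := lMap_eq_append l a
    obtain ⟨r, hr⟩ : ∃ r, lMap l b ++ lMap l c = l :: b :: r := by
      by_cases hb : b = l
      · subst hb
        obtain ⟨t, ht⟩ := lMap_eq_cons b c
        exact ⟨t, by simp [ht]⟩
      · exact ⟨lMap l c, by simp [lMap_of_ne hb]⟩
    refine ⟨_, hc, s, r, ?_⟩
    simp [hs, hr]

theorem nil_biE_Lang_lMap {K : Set (List A)} {l a b : A} (h : [a, b] ∈ Lang (lMap l) K) :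
    a = l ∨ b = l := by
  obtain ⟨u, -, s, t, h⟩ := h
  exact consecutive_flatMap_lMap (s := s) (t := t) (by rw [← h]; simp)

theorem self_self_mem_Lang_lMap {K : Set (List A)} (hK : IsLang K) {l : A} (hl : [l] ∈ K) :
    [l, l] ∈ Lang (lMap l) K := by
  obtain ⟨b, hb⟩ := hK.append_singleton hl
  obtain ⟨t, ht⟩ := lMap_eq_cons l b
  exact ⟨_, hb, [], t, by simp [ht]⟩

theorem exists_preimage_lMap {K : Set (List A)} (hK : IsLang K) {l : A} {w₀ w₁ : List A}
    (hw : w₀ ++ [l] ∈ Lang (lMap l) K) (h : w₀ ++ [l] = l :: w₁) :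
    ∃ u ∈ K, w₀ = u.flatMap (lMap l) := by
  obtain ⟨u, hu, s, t, h0⟩ := hw
  have h1 : s ++ l :: (w₁ ++ t) = u.flatMap (lMap l) := by rw [← h0, h]; simp
  obtain ⟨u₁, u₂, rfl, -, h2⟩ := decode_lMap h1
  have h3 : w₀ ++ l :: t = u₂.flatMap (lMap l) := by
    rw [← h2, ← List.cons_append, ← h]; simp
  obtain ⟨u₃, u₄, rfl, h4, -⟩ := decode_lMap h3
  exact ⟨u₃, hK.factor ⟨u₁, u₄, by simp⟩ hu, h4⟩

/-- An extension graph in `L_l(K)` is a double star, or an extension graph of a shorter word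
of `K`. -/
theorem relTree_or_shorter [Finite A] {K : Set (List A)} (hK : IsLang K) {l : A} (hl : [l] ∈ K)
    {w : List A} (hw : w ∈ Lang (lMap l) K) :
    RelTree (biE (Lang (lMap l) K) w) ∨
      ∃ w' ∈ K, w'.length < w.length ∧ biE (Lang (lMap l) K) w = biE K w' := by
  have hK' := Lang_isLang (lMap_ne_nil l) hK
  obtain ⟨⟨a₀, b₀⟩, h0⟩ := hK'.biE_nonempty hw
  rcases List.eq_nil_or_concat' w with rfl | ⟨w₀, d, rfl⟩
  · left
    refine relTree_of_doubleStar (l := l) (l' := l) (self_self_mem_Lang_lMap hK hl) ?_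
    rintro ⟨a, b⟩ hab
    exact nil_biE_Lang_lMap hab
  by_cases hd : d = l
  swap
  · left
    have key : ∀ p ∈ biE (Lang (lMap l) K) (w₀ ++ [d]), p.2 = l := by
      rintro ⟨a, b⟩ hab
      refine (nil_biE_Lang_lMap (K := K) (hK'.factor ⟨a :: w₀, [], by simp⟩ hab)).resolve_left hd
    exact relTree_of_doubleStar h0 fun p hp => Or.inr ((key p hp).trans (key _ h0).symm)
  subst hd
  obtain ⟨c, w₁, hc⟩ := List.exists_cons_of_ne_nil (l := w₀ ++ [d]) (by simp)
  by_cases hcd : c = d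
  swap
  · left
    have key : ∀ p ∈ biE (Lang (lMap d) K) (w₀ ++ [d]), p.1 = d := by
      rintro ⟨a, b⟩ hab
      rw [hc] at hab
      refine (nil_biE_Lang_lMap (K := K)
        (hK'.factor ⟨[], w₁ ++ [b], by simp⟩ hab)).resolve_right hcd
    exact relTree_of_doubleStar h0 fun p hp => Or.inl ((key p hp).trans (key _ h0).symm)
  subst hcd
  right
  obtain ⟨u, hu, rfl⟩ := exists_preimage_lMap hK hw hc
  refine ⟨u, hu, ?_, biE_Lang_lMap hK c u⟩
  have := length_le_flatMap (lMap_ne_nil c) u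
  rw [List.length_append, List.length_singleton]
  omega

theorem dendricL_Lang_lMap [Finite A] {K : Set (List A)} (hK : IsLang K) {l : A} (hl : [l] ∈ K)
    (h : DendricL K) : DendricL (Lang (lMap l) K) := by
  intro w hw
  rcases relTree_or_shorter hK hl hw with h1 | ⟨w', hw', -, h2⟩
  · exact h1
  · rw [h2]; exact h w' hw'

theorem dendricL_of_Lang_lMap {K : Set (List A)} (hK : IsLang K) {l : A}
    (h : DendricL (Lang (lMap l) K)) : DendricL K := by
  intro w hw
  rw [← biE_Lang_lMap hK l]
  apply h
  obtain ⟨c, hc⟩ := hK.append_singleton hw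
  obtain ⟨t, ht⟩ := lMap_eq_cons l c
  exact ⟨_, hc, [], t, by simp [ht]⟩

theorem Lang_rMap {K : Set (List A)} (hK : IsLang K) (l : A) :
    Lang (rMap l) K = Lang (lMap l) K :=
  (conjBy_rMap_lMap l).Lang_eq (rMap_ne_nil l) hK

theorem mem_lMap_self (l a : A) : l ∈ lMap l a := by
  obtain ⟨t, ht⟩ := lMap_eq_cons l a
  simp [ht]

theorem mem_lMap (l a : A) : a ∈ lMap l a := by
  obtain ⟨t, ht⟩ := lMap_eq_append l a
  simp [ht]

theorem singleton_mem_Lang {f : A → List B} {K : Set (List A)} {a : A} {b : B} (ha : [a] ∈ K)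
    (hb : b ∈ f a) : [b] ∈ Lang f K := by
  obtain ⟨s, t, hst⟩ := List.append_of_mem hb
  exact ⟨[a], ha, s, t, by simp [hst]⟩

/-! ### Existence of dendric words -/

/-- Every factor of `x` occurs arbitrarily far to the right. -/
def RightRec (x : ℤ → A) : Prop :=
  ∀ w ∈ language x, ∀ N : ℤ, ∃ k, N ≤ k ∧ w = window x k w.length

/-- A sequence of words in which every word is extended on both sides to give the next one
converges to a bi-infinite word. -/
theorem exists_limit_word {W P Q : ℕ → List A} (hW : ∀ n, W (n + 1) = P n ++ W n ++ Q n)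
    (hP : ∀ n, P n ≠ []) (hQ : ∀ n, Q n ≠ []) :
    ∃ x : ℤ → A, language x = {w | ∃ n, w <:+: W n} ∧
      ∀ n : ℕ, ∃ k : ℤ, n ≤ k ∧ Q n = window x k (Q n).length := by
  let p : ℕ → ℕ := fun n => ∑ i ∈ Finset.range n, (P i).length
  have hp1 : ∀ n, p (n + 1) = p n + (P n).length := fun n => Finset.sum_range_succ _ _
  have hp0 : p 0 = 0 := rfl
  have hpn : ∀ n, n ≤ p n := by
    intro n
    induction n with
    | zero => exact Nat.zero_le _
    | succ n ih =>
      have := List.length_pos_iff.2 (hP n)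
      rw [hp1]; omega
  have hlen : ∀ n, p n + n ≤ (W n).length := by
    intro n
    induction n with
    | zero => simp [hp0]
    | succ n ih =>
      have := List.length_pos_iff.2 (hQ n)
      rw [hp1, hW]
      simp only [List.length_append]
      omega
  have hstep : ∀ m n, ∀ i j : ℕ, m ≤ n → (hi : i < (W m).length) → i + p n = j + p m →
      (W n)[j]? = (W m)[i]? := by
    intro m n i j hmn hi
    induction n, hmn using Nat.le_induction generalizing j with
    | base => intro h; rw [Nat.add_right_cancel h]
    | succ n hmn ih =>
      intro h
      have hmono : p m ≤ p n :=
        Finset.sum_le_sum_of_subset (Finset.range_subset_range.2 hmn)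
      rw [hp1] at h
      obtain ⟨j', rfl⟩ : ∃ j', j = (P n).length + j' := Nat.exists_eq_add_of_le (by omega)
      have h1 := ih j' (by omega)
      have hj' : j' < (W n).length := by
        by_contra hcon
        rw [List.getElem?_eq_none (not_lt.1 hcon), List.getElem?_eq_getElem hi] at h1
        cases h1
      rw [hW, List.append_assoc, List.getElem?_append_right (by omega),
        Nat.add_sub_cancel_left, List.getElem?_append_left hj', h1]
  have hex : ∀ i : ℤ, ∃ a, ∀ m j : ℕ, (j : ℤ) = i + p m → ∀ h : j < (W m).length,
      (W m)[j] = a := by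
    intro i
    have h1 := hpn (i.natAbs + 1)
    have h2 := hlen (i.natAbs + 1)
    obtain ⟨J, hJ⟩ : ∃ J : ℕ, (J : ℤ) = i + p (i.natAbs + 1) :=
      ⟨(i + p (i.natAbs + 1)).toNat, by omega⟩
    have hJlt : J < (W (i.natAbs + 1)).length := by omega
    refine ⟨(W (i.natAbs + 1))[J], fun m j hj h => ?_⟩
    rw [← Option.some_inj, ← List.getElem?_eq_getElem, ← List.getElem?_eq_getElem]
    rcases le_total m (i.natAbs + 1) with hm | hm
    · exact (hstep _ _ j J hm h (by omega)).symm
    · exact hstep _ _ J j hm hJlt (by omega)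
  choose x hx using hex
  have hwin : ∀ n, W n = window x (-p n) (W n).length := by
    intro n
    rw [eq_window_iff]
    intro i hi
    exact hx _ n i (by ring) hi
  refine ⟨x, language_eq_of_windows hwin hpn hlen, fun n => ?_⟩
  have h1 := hwin (n + 1)
  conv_lhs at h1 => rw [hW]
  refine ⟨_, ?_, (window_eq_append h1.symm).2⟩
  have h2 := hlen n
  rw [hp1, List.length_append]
  push_cast
  omega

/-- The image of a word under the product of the morphisms `L_l`, for `l` in a list. -/
noncomputable def arWord (t : List A) (w : List A) : List A :=
  t.foldr (fun l w => w.flatMap (lMap l)) w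

@[simp] theorem arWord_nil (w : List A) : arWord [] w = w := rfl

@[simp] theorem arWord_cons (l : A) (t w : List A) :
    arWord (l :: t) w = (arWord t w).flatMap (lMap l) := rfl

theorem arWord_append_list (s t w : List A) : arWord (s ++ t) w = arWord s (arWord t w) := by
  simp [arWord]

theorem arWord_append (t u v : List A) : arWord t (u ++ v) = arWord t u ++ arWord t v := by
  induction t with
  | nil => rfl
  | cons l t ih => simp [ih]

theorem mem_arWord {t w : List A} {a : A} (h : a ∈ w) : a ∈ arWord t w := by
  induction t with
  | nil => exact h
  | cons l t ih =>
    rw [arWord_cons, List.mem_flatMap]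
    exact ⟨a, ih, mem_lMap l a⟩

theorem mem_arWord_of_mem {t w : List A} {a : A} (h : a ∈ t) (hw : w ≠ []) :
    a ∈ arWord t w := by
  induction t with
  | nil => cases h
  | cons l t ih =>
    rw [arWord_cons, List.mem_flatMap]
    rcases List.mem_cons.1 h with rfl | h
    · obtain ⟨b, w', rfl⟩ := List.exists_cons_of_ne_nil hw
      exact ⟨b, mem_arWord List.mem_cons_self, mem_lMap_self a b⟩
    · exact ⟨a, ih h, mem_lMap l a⟩

theorem mem_or_of_mem_arWord {t w : List A} {a : A} (h : a ∈ arWord t w) : a ∈ t ∨ a ∈ w := by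
  induction t generalizing a with
  | nil => exact Or.inr h
  | cons l t ih =>
    rw [arWord_cons, List.mem_flatMap] at h
    obtain ⟨b, hb, hab⟩ := h
    have : a = l ∨ a = b := by
      by_cases hbl : b = l
      · subst hbl; simpa using hab
      · simpa [lMap_of_ne hbl] using hab
    rcases this with rfl | rfl
    · exact Or.inl List.mem_cons_self
    · exact (ih hb).imp_left (List.mem_cons_of_mem l)

theorem iterate_arWord_append (t : List A) (m : ℕ) (u v : List A) :
    (arWord t)^[m] (u ++ v) = (arWord t)^[m] u ++ (arWord t)^[m] v := by
  induction m generalizing u v with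
  | zero => rfl
  | succ m ih => rw [Function.iterate_succ_apply, arWord_append, ih]; rfl

theorem mem_iterate_arWord {t w : List A} {a : A} (m : ℕ) (h : a ∈ w) :
    a ∈ (arWord t)^[m] w := by
  induction m generalizing w with
  | zero => exact h
  | succ m ih => exact ih (mem_arWord h)

/-- The factors of the words `t(t₀^m(c))`, where a list of letters stands for the product of the
corresponding morphisms `L_l`. -/
def arLang (t₀ : List A) (c : A) (t : List A) : Set (List A) :=
  {w | ∃ m, w <:+: arWord t ((arWord t₀)^[m] [c])}

theorem arLang_cons (t₀ : List A) (c l : A) (t : List A) :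
    arLang t₀ c (l :: t) = Lang (lMap l) (arLang t₀ c t) := by
  ext w
  constructor
  · rintro ⟨m, h⟩
    exact ⟨_, ⟨m, List.infix_refl _⟩, h⟩
  · rintro ⟨u, ⟨m, h1⟩, h2⟩
    exact ⟨m, h2.trans (infix_flatMap h1 _)⟩

section ArLang

variable {t₀ : List A} {c : A} {u v : List A} (h₀ : arWord t₀ [c] = u ++ [c] ++ v)
include h₀

theorem iterate_arWord_succ (m : ℕ) : (arWord t₀)^[m + 1] [c] =
    (arWord t₀)^[m] u ++ (arWord t₀)^[m] [c] ++ (arWord t₀)^[m] v := by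
  rw [Function.iterate_succ_apply, h₀, iterate_arWord_append, iterate_arWord_append]

theorem arLang_self : arLang t₀ c t₀ = arLang t₀ c [] := by
  ext w
  constructor
  · rintro ⟨m, h⟩
    refine ⟨m + 1, ?_⟩
    rwa [arWord_nil, Function.iterate_succ_apply']
  · rintro ⟨m, h⟩
    refine ⟨m, h.trans ?_⟩
    rw [arWord_nil, ← Function.iterate_succ_apply' (arWord t₀), iterate_arWord_succ h₀]
    exact ⟨_, _, rfl⟩

theorem arLang_isLang (hu : u ≠ []) (hv : v ≠ []) (t : List A) : IsLang (arLang t₀ c t) := by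
  induction t with
  | cons l t ih => rw [arLang_cons]; exact Lang_isLang (lMap_ne_nil l) ih
  | nil =>
    refine ⟨⟨0, ⟨[], [c], rfl⟩⟩, fun h => ?_, ?_⟩
    · rintro ⟨m, h'⟩
      exact ⟨m, h.trans h'⟩
    · rintro w ⟨m, s, r, h⟩
      rw [arWord_nil] at h
      obtain ⟨b, hb⟩ := List.exists_mem_of_ne_nil u hu
      obtain ⟨d, hd⟩ := List.exists_mem_of_ne_nil v hv
      have h1 := List.ne_nil_of_mem (mem_iterate_arWord (t := t₀) m hb)
      have h2 := List.ne_nil_of_mem (mem_iterate_arWord (t := t₀) m hd)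
      obtain ⟨s₀, a', hs⟩ := List.eq_nil_or_concat' ((arWord t₀)^[m] u ++ s)
        |>.resolve_left (by simp [h1])
      obtain ⟨b', r₀, hr⟩ := List.exists_cons_of_ne_nil (l := r ++ (arWord t₀)^[m] v) (by simp [h2])
      refine ⟨a', b', m + 1, s₀, r₀, ?_⟩
      rw [arWord_nil, iterate_arWord_succ h₀, ← h]
      have : (arWord t₀)^[m] u ++ (s ++ w ++ r) ++ (arWord t₀)^[m] v =
        ((arWord t₀)^[m] u ++ s) ++ w ++ (r ++ (arWord t₀)^[m] v) := by simp
      rw [this, hs, hr]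
      simp

theorem singleton_mem_arLang {a : A} (ha : a ∈ t₀) (t : List A) : [a] ∈ arLang t₀ c t := by
  induction t with
  | cons l t ih => rw [arLang_cons]; exact singleton_mem_Lang ih (mem_lMap l a)
  | nil =>
    rw [← arLang_self h₀]
    obtain ⟨s, r, h⟩ := List.append_of_mem (mem_arWord_of_mem (w := [c]) ha (by simp))
    exact ⟨0, s, r, by rw [Function.iterate_zero, id, h]; simp⟩

/-- By induction on the length of the word: every extension graph which is not a double star is
also the extension graph of a shorter word in a language of the same family. -/
theorem arLang_dendric [Finite A] (hu : u ≠ []) (hv : v ≠ []) :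
    DendricL (arLang t₀ c []) := by
  suffices H : ∀ n, ∀ t : List A, t ⊆ t₀ → ∀ w ∈ arLang t₀ c t, w.length < n →
      RelTree (biE (arLang t₀ c t) w) from
    fun w hw => H _ [] (by simp) w hw (Nat.lt_succ_self _)
  intro n
  induction n with
  | zero => intro t _ w _ h; exact absurd h (Nat.not_lt_zero _)
  | succ n ih =>
    have step : ∀ (l : A) (t : List A), l :: t ⊆ t₀ → ∀ w ∈ arLang t₀ c (l :: t),
        w.length < n + 1 → RelTree (biE (arLang t₀ c (l :: t)) w) := by
      intro l t ht w hw hn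
      rw [arLang_cons] at hw ⊢
      rcases relTree_or_shorter (arLang_isLang h₀ hu hv t)
        (singleton_mem_arLang h₀ (ht List.mem_cons_self) t) hw with h | ⟨w', hw', hlt, h⟩
      · exact h
      · rw [h]
        exact ih t (fun a ha => ht (List.mem_cons_of_mem l ha)) w' hw' (by omega)
    intro t ht w hw hn
    cases t with
    | cons l t => exact step l t ht w hw hn
    | nil =>
      rw [← arLang_self h₀] at hw ⊢
      cases t₀ with
      | nil =>
        have := congrArg List.length h₀
        have := List.length_pos_iff.2 hu
        simp at *
        omega
      | cons l t => exact step l t (List.Subset.refl _) w hw hn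

theorem exists_word_of_arLang (hu : u ≠ []) (hc : c ∈ v) :
    ∃ x : ℤ → A, language x = arLang t₀ c [] ∧ RightRec x := by
  obtain ⟨b, hb⟩ := List.exists_mem_of_ne_nil u hu
  obtain ⟨x, hx, hQ⟩ := exists_limit_word (W := fun m => (arWord t₀)^[m] [c])
    (iterate_arWord_succ h₀) (fun m => List.ne_nil_of_mem (mem_iterate_arWord m hb))
    (fun m => List.ne_nil_of_mem (mem_iterate_arWord m hc))
  refine ⟨x, hx, fun w hw N => ?_⟩
  rw [hx] at hw
  obtain ⟨n, hn⟩ := hw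
  have hmono : ∀ m, n ≤ m → w <:+: (arWord t₀)^[m] [c] := by
    intro m hm
    induction m, hm using Nat.le_induction with
    | base => exact hn
    | succ m _ ih =>
      rw [iterate_arWord_succ h₀]
      exact ih.trans ⟨_, _, rfl⟩
  obtain ⟨s, r, hsr⟩ := List.append_of_mem hc
  obtain ⟨k, hk, hQk⟩ := hQ (n + N.natAbs)
  have h1 : w <:+: (arWord t₀)^[n + N.natAbs] v := by
    refine (hmono _ (Nat.le_add_right n N.natAbs)).trans ?_
    have h2 : s ++ c :: r = s ++ [c] ++ r := by simp
    rw [hsr, h2, iterate_arWord_append, iterate_arWord_append]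
    exact ⟨_, _, rfl⟩
  rw [hQk] at h1
  obtain ⟨l, hl, hwl⟩ := infix_window h1
  exact ⟨l, by omega, hwl⟩

end ArLang

theorem pair_mem_Lang_lMap {K : Set (List A)} (hK : IsLang K) {a l : A} (ha : [a] ∈ K)
    (hl : [l] ∈ K) : [a, l] ∈ Lang (lMap l) K ∧ [l, a] ∈ Lang (lMap l) K := by
  by_cases h : a = l
  · subst h
    exact ⟨self_self_mem_Lang_lMap hK hl, self_self_mem_Lang_lMap hK hl⟩
  · obtain ⟨b, hb⟩ := hK.append_singleton ha
    obtain ⟨t, ht⟩ := lMap_eq_cons l b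
    exact ⟨⟨_, hb, [l], t, by simp [ht, lMap_of_ne h]⟩,
      ⟨_, hb, [], lMap l b, by simp [lMap_of_ne h]⟩⟩

/-- There are dendric words over any finite set of at least two letters, in which the extension
graph of the empty word is the double star centred at a prescribed letter. -/
theorem exists_dendric [Finite A] (r : List A) {c d : A} (hc : c ∈ r) (hd : d ∈ r)
    (hcd : c ≠ d) : ∃ x : ℤ → A, DendricL (language x) ∧ RightRec x ∧ (∀ n, x n ∈ r) ∧
      ∀ a ∈ r, [a, c] ∈ language x ∧ [c, a] ∈ language x := by
  -- the prefix `c d c d c` of the directive list makes the seed occur inside its own image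
  set t₀ := [c, d, c, d, c] ++ r with ht₀
  obtain ⟨s, hs⟩ : ∃ s, arWord r [c] = s ++ [c] := by
    clear hc hd ht₀ t₀
    induction r with
    | nil => exact ⟨[], rfl⟩
    | cons l r ih =>
      obtain ⟨s, hs⟩ := ih
      obtain ⟨s', hs'⟩ := lMap_eq_append l c
      exact ⟨s.flatMap (lMap l) ++ s', by simp [hs, hs']⟩
  have h₀ : arWord t₀ [c] =
      (arWord [c, d, c, d, c] s ++ [c, d]) ++ [c] ++ [c, d, c, d, c] := by
    rw [ht₀, arWord_append_list, hs, arWord_append]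
    simp [lMap_of_ne hcd, lMap_of_ne hcd.symm]
  have hu : arWord [c, d, c, d, c] s ++ [c, d] ≠ [] := by simp
  have hv : [c, d, c, d, c] ≠ [] := by simp
  have hsub : ∀ a ∈ t₀, a ∈ r := by
    intro a ha
    simp only [ht₀, List.cons_append, List.nil_append, List.mem_cons] at ha
    rcases ha with rfl | rfl | rfl | rfl | rfl | ha <;> assumption
  obtain ⟨x, hx, hrec⟩ := exists_word_of_arLang h₀ hu (by simp)
  refine ⟨x, hx ▸ arLang_dendric h₀ hu hv, hrec, fun n => ?_, fun a ha => ?_⟩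
  · have h1 : [x n] ∈ language x := ⟨n, 1, by simp⟩
    rw [hx] at h1
    obtain ⟨m, hm⟩ := h1
    have h2 : x n ∈ (arWord t₀)^[m] [c] := hm.subset (by simp)
    have h3 : ∀ m, ∀ a ∈ (arWord t₀)^[m] [c], a ∈ r := by
      intro m
      induction m with
      | zero => intro a ha; rwa [List.mem_singleton.1 ha]
      | succ m ih =>
        intro a ha
        rw [Function.iterate_succ_apply'] at ha
        exact (mem_or_of_mem_arWord ha).elim (hsub a) (ih a)
    exact h3 m _ h2
  · have hat : a ∈ t₀ := List.mem_append_right _ ha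
    have hct : c ∈ t₀ := List.mem_append_right _ hc
    rw [hx, ← arLang_self h₀]
    have ht : t₀ = c :: ([d, c, d, c] ++ r) := rfl
    rw [show arLang t₀ c t₀ = arLang t₀ c (c :: ([d, c, d, c] ++ r)) from rfl, arLang_cons]
    exact pair_mem_Lang_lMap (arLang_isLang h₀ hu hv _) (singleton_mem_arLang h₀ hat _)
      (singleton_mem_arLang h₀ hct _)

/-! ### Inserting a new letter in a dendric word -/

/-- The letter `b` is inserted in `z` just before position `n`. -/
def insertLetter (z : ℤ → A) (n : ℤ) (b : A) (i : ℤ) : A :=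
  if i < n then z i else if i = n then b else z (i - 1)

section Insert

variable {z : ℤ → A} {n : ℤ} {b : A}

theorem insertLetter_of_lt {i : ℤ} (h : i < n) : insertLetter z n b i = z i := by
  simp [insertLetter, h]

@[simp] theorem insertLetter_self : insertLetter z n b n = b := by
  simp [insertLetter]

theorem insertLetter_of_gt {i : ℤ} (h : n < i) : insertLetter z n b i = z (i - 1) := by
  simp [insertLetter, h.not_gt, h.ne']

theorem window_insertLetter_left {k : ℤ} {m : ℕ} (h : k + m ≤ n) :
    window (insertLetter z n b) k m = window z k m := by
  refine List.ext_getElem (by simp) fun i h1 h2 => ?_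
  rw [window_length] at h1
  rw [window_getElem, window_getElem, insertLetter_of_lt (by omega)]

theorem window_insertLetter_right {k : ℤ} {m : ℕ} (h : n ≤ k) :
    window (insertLetter z n b) (k + 1) m = window z k m := by
  refine List.ext_getElem (by simp) fun i h1 h2 => ?_
  rw [window_length] at h1
  rw [window_getElem, window_getElem, insertLetter_of_gt (by omega)]
  congr 1
  ring

theorem insertLetter_eq_iff (hb : ∀ i, z i ≠ b) {i : ℤ} : insertLetter z n b i = b ↔ i = n := by
  constructor
  · intro h
    unfold insertLetter at h
    split_ifs at h with h1 h2
    · exact absurd h (hb _)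
    · exact h2
    · exact absurd h (hb _)
  · rintro rfl
    simp

theorem mem_biE_language {x : ℤ → A} {w : List A} {a c : A} :
    (a, c) ∈ biE (language x) w ↔
      ∃ k, w = window x k w.length ∧ a = x (k - 1) ∧ c = x (k + w.length) := by
  rw [mem_biE, mem_language_iff]
  have hl : (a :: (w ++ [c])).length = w.length + 1 + 1 := by simp
  rw [hl]
  constructor
  · rintro ⟨k, h⟩
    rw [window_succ', window_succ] at h
    obtain ⟨h1, h2⟩ := List.cons.inj h
    obtain ⟨h3, h4⟩ := List.append_inj h2 (by simp)
    exact ⟨k + 1, h3, by rw [h1]; simp, by simpa using h4⟩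
  · rintro ⟨k, h1, h2, h3⟩
    refine ⟨k - 1, ?_⟩
    rw [window_succ', window_succ, ← h2, sub_add_cancel, ← h1, ← h3]

theorem language_subset_insertLetter (hrec : RightRec z) :
    language z ⊆ language (insertLetter z n b) := by
  intro w hw
  obtain ⟨k, hk, h⟩ := hrec w hw n
  rw [h, ← window_insertLetter_right (b := b) hk]
  exact window_mem_language _ _ _

theorem mem_language_of_insertLetter {w : List A}
    (hw : w ∈ language (insertLetter z n b)) (hbw : b ∉ w) : w ∈ language z := by
  obtain ⟨k, m, rfl⟩ := hw
  by_cases h1 : k + m ≤ n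
  · rw [window_insertLetter_left h1]; exact window_mem_language _ _ _
  by_cases h2 : n + 1 ≤ k
  · obtain ⟨k, rfl⟩ : ∃ k', k = k' + 1 := ⟨k - 1, by ring⟩
    rw [window_insertLetter_right (by omega)]; exact window_mem_language _ _ _
  · exfalso
    apply hbw
    obtain ⟨i, hi⟩ := Int.le.dest (show k ≤ n by omega)
    rw [List.mem_iff_getElem]
    exact ⟨i, by rw [window_length]; omega, by rw [window_getElem, hi]; simp⟩

/-- The extension graph of a word without the inserted letter gets at most two more edges, each of
which joins the new letter to a vertex which was already there. -/
theorem biE_insertLetter (hb : ∀ i, z i ≠ b) (hrec : RightRec z) {w : List A} (hw : b ∉ w)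
    {p : A × A} : p ∈ biE (language (insertLetter z n b)) w ↔ p ∈ biE (language z) w ∨
      (w = window z n w.length ∧ p = (b, z (n + w.length))) ∨
      (w = window z (n - w.length) w.length ∧ p = (z (n - w.length - 1), b)) := by
  obtain ⟨a, c⟩ := p
  constructor
  · intro h
    by_cases hbw : b ∈ a :: (w ++ [c])
    · right
      obtain ⟨k, h1, h2, h3⟩ := mem_biE_language.1 h
      simp only [List.mem_cons, List.mem_append, hw, false_or, List.not_mem_nil, or_false] at hbw
      rcases hbw with hba | hbc
      · left
        have hk : k - 1 = n := (insertLetter_eq_iff hb).1 (h2.symm.trans hba.symm)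
        obtain rfl : k = n + 1 := by omega
        rw [window_insertLetter_right le_rfl] at h1
        refine ⟨h1, ?_⟩
        rw [hba, h3, insertLetter_of_gt (by omega)]
        congr 2
        ring
      · right
        have hk : k + w.length = n := (insertLetter_eq_iff hb).1 (h3.symm.trans hbc.symm)
        obtain rfl : k = n - w.length := by omega
        rw [window_insertLetter_left (by omega)] at h1
        refine ⟨h1, ?_⟩
        rw [hbc, h2, insertLetter_of_lt (by omega)]
    · exact Or.inl (mem_language_of_insertLetter h hbw)
  · rintro (h | ⟨h1, h2⟩ | ⟨h1, h2⟩)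
    · exact language_subset_insertLetter hrec h
    · rw [h2, mem_biE_language]
      refine ⟨n + 1, ?_, by simp, ?_⟩
      · rw [window_insertLetter_right le_rfl]; exact h1
      · rw [insertLetter_of_gt (by omega)]
        congr 1
        ring
    · rw [h2, mem_biE_language]
      refine ⟨n - w.length, ?_, ?_, by simp⟩
      · rw [window_insertLetter_left (by omega)]; exact h1
      · rw [insertLetter_of_lt (by omega)]

theorem dendricL_insertLetter [Finite A] (hb : ∀ i, z i ≠ b) (hrec : RightRec z)
    (hz : DendricL (language z)) : DendricL (language (insertLetter z n b)) := by
  intro w hw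
  by_cases hbw : b ∈ w
  · -- the word has only one occurrence
    obtain ⟨⟨a₀, c₀⟩, h0⟩ := (language_isLang _).biE_nonempty hw
    refine relTree_of_doubleStar h0 ?_
    rintro ⟨a, c⟩ h
    obtain ⟨k, h1, h2, -⟩ := mem_biE_language.1 h
    obtain ⟨k₀, h4, h5, -⟩ := mem_biE_language.1 h0
    obtain ⟨i, hi, hbi⟩ := List.mem_iff_getElem.1 hbw
    have h7 := (insertLetter_eq_iff hb).1 ((eq_window_iff.1 h1 i hi).symm.trans hbi)
    have h8 := (insertLetter_eq_iff hb).1 ((eq_window_iff.1 h4 i hi).symm.trans hbi)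
    obtain rfl : k = k₀ := by omega
    exact Or.inl (h2.trans h5.symm)
  · have hwz := mem_language_of_insertLetter hw hbw
    have hR := hz w hwz
    set R := biE (language z) w with hRdef
    have hfst : ∀ p ∈ R, p.1 ≠ b := by
      rintro ⟨a, c⟩ hp
      obtain ⟨k, -, h2, -⟩ := mem_biE_language.1 hp
      exact h2 ▸ hb _
    have hsnd : ∀ p ∈ R, p.2 ≠ b := by
      rintro ⟨a, c⟩ hp
      obtain ⟨k, -, -, h2⟩ := mem_biE_language.1 hp
      exact h2 ▸ hb _
    have hleft : ∃ R₁, RelTree R₁ ∧ R ⊆ R₁ ∧ (∀ p ∈ R₁, p.2 ≠ b) ∧ ∀ p, p ∈ R₁ ↔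
        p ∈ R ∨ (w = window z n w.length ∧ p = (b, z (n + w.length))) := by
      by_cases h : w = window z n w.length
      · refine ⟨insert (b, z (n + w.length)) R, ?_, Set.subset_insert _ _, ?_, ?_⟩
        · refine hR.insert_left (a' := z (n - 1)) (mem_biE_language.2 ⟨n, h, rfl, rfl⟩) ?_
          rintro ⟨p, hp, hpb⟩
          exact hfst p hp hpb
        · rintro p (rfl | hp)
          · exact hb _
          · exact hsnd p hp
        · intro p
          rw [Set.mem_insert_iff, or_comm, and_iff_right h]
      · exact ⟨R, hR, le_rfl, hsnd, fun p => by simp [h]⟩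
    obtain ⟨R₁, hR₁, hsub, hsnd₁, hmem₁⟩ := hleft
    by_cases h : w = window z (n - w.length) w.length
    · have : biE (language (insertLetter z n b)) w =
          insert (z (n - w.length - 1), b) R₁ := by
        ext p
        rw [biE_insertLetter hb hrec hbw, Set.mem_insert_iff, hmem₁, and_iff_right h]
        tauto
      rw [this]
      refine hR₁.insert_right (b' := z (n - w.length + w.length))
        (hsub (mem_biE_language.2 ⟨_, h, rfl, rfl⟩)) ?_
      rintro ⟨p, hp, hpb⟩
      exact hsnd₁ p hp hpb
    · have : biE (language (insertLetter z n b)) w = R₁ := by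
        ext p
        rw [biE_insertLetter hb hrec hbw, hmem₁]
        tauto
      rw [this]
      exact hR₁

end Insert

theorem isOver_iff {x : ℤ → A} : IsOver x ↔ ∀ a, [a] ∈ language x := by
  refine forall_congr' fun a => ?_
  rw [mem_language_iff]
  simp [eq_comm]

/-- The languages of the dendric words over `A`. -/
def IsDendricLanguage (K : Set (List A)) : Prop :=
  ∃ x : ℤ → A, IsOver x ∧ IsDendric x ∧ K = language x

theorem exists_dendric_star [Finite A] [Nontrivial A] (c : A) :
    ∃ K : Set (List A), IsDendricLanguage K ∧ ∀ a, [a, c] ∈ K ∧ [c, a] ∈ K := by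
  have := Fintype.ofFinite A
  obtain ⟨d, hd⟩ := exists_ne c
  obtain ⟨x, hx, -, -, h⟩ := exists_dendric (Finset.univ : Finset A).toList (c := c) (d := d)
    (by simp) (by simp) hd.symm
  refine ⟨_, ⟨x, ?_, (isDendric_iff x).2 hx, rfl⟩, fun a => h a (by simp)⟩
  rw [isOver_iff]
  exact fun a => (language_isLang x).factor ⟨[], [c], by simp⟩ (h a (by simp)).1

/-- A dendric word in which `b` occurs only once, between `a` and `c` in one order or the other:
the right (or left) vertices `a` and `b` of the extension graph of the empty word have no common
neighbour. -/
theorem exists_dendric_insert [Finite A] {a b c : A} (hab : a ≠ b) (hac : a ≠ c)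
    (hbc : b ≠ c) :
    (∃ K : Set (List A), IsDendricLanguage K ∧
      [c, a] ∈ K ∧ [a, c] ∈ K ∧ [c, c] ∈ K ∧ [a, b] ∈ K) ∧
    (∃ K : Set (List A), IsDendricLanguage K ∧
      [c, a] ∈ K ∧ [a, c] ∈ K ∧ [c, c] ∈ K ∧ [b, a] ∈ K) := by
  classical
  have := Fintype.ofFinite A
  have hr : ∀ e, e ∈ (Finset.univ.erase b : Finset A).toList ↔ e ≠ b := by simp
  obtain ⟨z, hz, hrec, hmem, h⟩ := exists_dendric (Finset.univ.erase b : Finset A).toList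
    (c := c) (d := a) ((hr c).2 hbc.symm) ((hr a).2 hab) hac.symm
  have hb : ∀ i, z i ≠ b := fun i => (hr _).1 (hmem i)
  have key : ∀ n, IsDendricLanguage (language (insertLetter z n b)) := by
    intro n
    refine ⟨_, ?_, (isDendric_iff _).2 (dendricL_insertLetter hb hrec hz), rfl⟩
    rw [isOver_iff]
    intro e
    by_cases he : e = b
    · exact ⟨n, 1, by simp [he]⟩
    · exact language_subset_insertLetter hrec
        ((language_isLang z).factor ⟨[], [c], by simp⟩ (h e ((hr e).2 he)).1)
  have hpairs : ∀ n, [c, a] ∈ language (insertLetter z n b) ∧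
      [a, c] ∈ language (insertLetter z n b) ∧ [c, c] ∈ language (insertLetter z n b) := by
    intro n
    exact ⟨language_subset_insertLetter hrec (h a ((hr a).2 hab)).2,
      language_subset_insertLetter hrec (h a ((hr a).2 hab)).1,
      language_subset_insertLetter hrec (h c ((hr c).2 hbc.symm)).1⟩
  obtain ⟨k, hk⟩ := mem_language_iff.1 (h a ((hr a).2 hab)).1
  have hka : z k = a := by
    have := eq_window_iff.1 hk 0 (by simp)
    simpa using this.symm
  refine ⟨⟨_, key (k + 1), (hpairs _).1, (hpairs _).2.1, (hpairs _).2.2, k, 2, ?_⟩,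
    ⟨_, key k, (hpairs _).1, (hpairs _).2.1, (hpairs _).2.2, k, 2, ?_⟩⟩
  · rw [window_succ, window_one, insertLetter_of_lt (by omega), hka]
    simp
  · rw [window_succ, window_one, Nat.cast_one, insertLetter_self,
      insertLetter_of_gt (i := k + 1) (by omega), add_sub_cancel_right, hka]
    simp

/-! ### A lower bound for the complexity of dendric words -/

/-- The words of length `n` of `K`. -/
def level (K : Set (List A)) (n : ℕ) : Set (List A) := {w | w ∈ K ∧ w.length = n}

theorem level_finite [Finite A] (K : Set (List A)) (n : ℕ) : (level K n).Finite :=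
  (List.finite_length_eq A n).subset fun _ h => h.2

/-- In a dendric language, two letters are joined by a chain in which consecutive letters are
right extensions of a common word of length `n`. -/
theorem right_chain_level {K : Set (List B)} (hK : IsLang K) (hd : DendricL K)
    (hall : ∀ b, [b] ∈ K) (n : ℕ) (b b' : B) :
    Relation.ReflTransGen (fun c d => ∃ v, v.length = n ∧ v ++ [c] ∈ K ∧ v ++ [d] ∈ K) b b' := by
  induction n with
  | zero => exact .single ⟨[], rfl, hall b, hall b'⟩
  | succ n ih =>
    induction ih with
    | refl => exact .refl
    | tail _ hcd ih =>
      obtain ⟨v, hv, h1, h2⟩ := hcd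
      have hvK : v ∈ K := hK.factor (List.prefix_append v _).isInfix h1
      refine ih.trans ?_
      have := (hd v hvK).connRel.right_chain (by rw [hK.snd_image_biE]; exact h1)
        (by rw [hK.snd_image_biE]; exact h2)
      refine Relation.ReflTransGen.mono ?_ _ _ this
      rintro c d ⟨a, hac, had⟩
      exact ⟨a :: v, by simp [hv], hac, had⟩

/-- The graph which joins a word `v` of length `n` to the letters `b` such that `vb` is in `K` is
connected, and its edges are the words of length `n + 1`. -/
theorem level_step [Finite B] [Nonempty B] {K : Set (List B)} (hK : IsLang K) (hd : DendricL K)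
    (hall : ∀ b, [b] ∈ K) (n : ℕ) :
    (level K n).ncard + Nat.card B ≤ (level K (n + 1)).ncard + 1 := by
  have hfin : Finite (level K n) := level_finite K n
  let G : SimpleGraph (level K n ⊕ B) := SimpleGraph.fromRel fun u w =>
    ∃ (v : level K n) (b : B), u = Sum.inl v ∧ w = Sum.inr b ∧ (v : List B) ++ [b] ∈ K
  have hadj : ∀ (v : level K n) (b : B), (v : List B) ++ [b] ∈ K →
      G.Adj (Sum.inl v) (Sum.inr b) := fun v b h => by
    rw [SimpleGraph.fromRel_adj]
    exact ⟨by simp, Or.inl ⟨v, b, rfl, rfl, h⟩⟩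
  have hB : ∀ b b' : B, G.Reachable (Sum.inr b) (Sum.inr b') := by
    intro b b'
    induction right_chain_level hK hd hall n b b' with
    | refl => rfl
    | tail _ hcd ih =>
      obtain ⟨v, hv, h1, h2⟩ := hcd
      have hvK : v ∈ K := hK.factor (List.prefix_append v _).isInfix h1
      exact ih.trans ((hadj ⟨v, hvK, hv⟩ _ h1).symm.reachable.trans
        (hadj ⟨v, hvK, hv⟩ _ h2).reachable)
  have hV : ∀ v : level K n, ∃ b, G.Reachable (Sum.inl v) (Sum.inr b) := by
    intro v
    obtain ⟨b, hb⟩ := hK.append_singleton v.2.1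
    exact ⟨b, (hadj v b hb).reachable⟩
  have hconn : G.Connected := by
    have : Nonempty (level K n ⊕ B) := ⟨Sum.inr (Classical.arbitrary B)⟩
    refine SimpleGraph.Connected.mk ?_
    rintro (v | b) (v' | b')
    · obtain ⟨b, hb⟩ := hV v
      obtain ⟨b', hb'⟩ := hV v'
      exact hb.trans ((hB b b').trans hb'.symm)
    · obtain ⟨b, hb⟩ := hV v
      exact hb.trans (hB b b')
    · obtain ⟨c, hc⟩ := hV v'
      exact (hB b c).trans hc.symm
    · exact hB b b'
  have h1 := hconn.card_vert_le_card_edgeSet_add_one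
  rw [Nat.card_sum, Nat.card_coe_set_eq, Nat.card_coe_set_eq] at h1
  refine h1.trans (Nat.add_le_add_right ?_ 1)
  let E : Set (level K n × B) := {p | (p.1 : List B) ++ [p.2] ∈ K}
  have hE : G.edgeSet ⊆ (fun p : level K n × B => s(Sum.inl p.1, Sum.inr p.2)) '' E := by
    intro e he
    induction e using Sym2.ind with
    | _ u w =>
      rw [SimpleGraph.mem_edgeSet, SimpleGraph.fromRel_adj] at he
      rcases he.2 with ⟨v, b, hu, hw, h⟩ | ⟨v, b, hu, hw, h⟩
      · exact ⟨(v, b), h, by rw [hu, hw]⟩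
      · exact ⟨(v, b), h, by rw [hu, hw]; exact Sym2.eq_swap⟩
  refine (Set.ncard_le_ncard hE (Set.toFinite _)).trans ?_
  refine (Set.ncard_image_le (Set.toFinite _)).trans ?_
  refine Set.ncard_le_ncard_of_injOn (fun p => (p.1 : List B) ++ [p.2]) ?_ ?_ (level_finite K _)
  · rintro ⟨v, b⟩ h
    exact ⟨h, by simp [v.2.2]⟩
  · rintro ⟨v, b⟩ _ ⟨v', b'⟩ _ h
    obtain ⟨h1, h2⟩ := List.append_inj' h rfl
    rw [Prod.mk.injEq]
    exact ⟨Subtype.ext h1, (List.cons.inj h2).1⟩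

theorem level_lower_bound [Finite B] [Nonempty B] {K : Set (List B)} (hK : IsLang K)
    (hd : DendricL K) (hall : ∀ b, [b] ∈ K) (n : ℕ) :
    n * Nat.card B + 1 ≤ (level K n).ncard + n := by
  induction n with
  | zero =>
    have : (level K 0).Nonempty := ⟨[], hK.nil_mem, rfl⟩
    have := (Set.ncard_pos (level_finite K 0)).2 this
    omega
  | succ n ih =>
    have := level_step hK hd hall n
    rw [Nat.succ_mul]
    omega

/-! ### Images of words with large powers of a letter -/

/-- The letters different from `l` are separated by at least `N` letters in the words of `K`. -/
def Sparse (l : A) (N : ℕ) (K : Set (List A)) : Prop :=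
  ∀ p q m, p ≠ l → q ≠ l → p :: (m ++ [q]) ∈ K → N ≤ m.length

theorem Sparse.Lang_lMap {l : A} {N : ℕ} {K : Set (List A)} (hK : IsLang K)
    (h : Sparse l N K) : Sparse l (N + 1) (Lang (lMap l) K) := by
  intro p q m hp hq hm
  have hK' := Lang_isLang (lMap_ne_nil l) hK
  rcases List.eq_nil_or_concat' m with rfl | ⟨w₀, d, rfl⟩
  · exact ((nil_biE_Lang_lMap hm).elim hp hq).elim
  obtain rfl : d = l := (nil_biE_Lang_lMap (K := K)
    (hK'.factor ⟨p :: w₀, [], by simp⟩ hm)).resolve_right hq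
  obtain ⟨c, w₁, hc⟩ := List.exists_cons_of_ne_nil (l := w₀ ++ [d]) (by simp)
  have hm' := hm
  rw [hc] at hm'
  obtain rfl : c = d := (nil_biE_Lang_lMap (K := K)
    (hK'.factor ⟨[], w₁ ++ [q], by simp⟩ hm')).resolve_left hp
  obtain ⟨u, -, rfl⟩ := exists_preimage_lMap hK (hK'.factor ⟨[p], [q], by simp⟩ hm) hc
  have h1 : (p, q) ∈ biE (Lang (lMap c) K) (u.flatMap (lMap c) ++ [c]) := hm
  rw [biE_Lang_lMap hK] at h1
  have h2 := h p q u hp hq h1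
  have h3 := length_le_flatMap (lMap_ne_nil c) u
  rw [List.length_append, List.length_singleton]
  omega

theorem Sparse.shape {l : A} {N : ℕ} {K : Set (List A)} (hK : IsLang K) (h : Sparse l N K)
    {u : List A} (hu : u ∈ K) (hN : u.length ≤ N + 1) :
    ∃ b i j, i ≤ N + 1 ∧ j ≤ N + 1 ∧
      u <:+: List.replicate i l ++ [b] ++ List.replicate j l := by
  by_cases hl : ∀ a ∈ u, a = l
  · refine ⟨l, u.length, 0, hN, Nat.zero_le _, [], [l], ?_⟩
    rw [← List.eq_replicate_of_mem hl]
    simp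
  · push Not at hl
    obtain ⟨b, hb, hbl⟩ := hl
    obtain ⟨s, t, rfl⟩ := List.append_of_mem hb
    have hs : ∀ a ∈ s, a = l := by
      intro a ha
      by_contra hal
      obtain ⟨s₁, s₂, rfl⟩ := List.append_of_mem ha
      have := h a b s₂ hal hbl (hK.factor ⟨s₁, t, by simp⟩ hu)
      simp at hN
      omega
    have ht : ∀ a ∈ t, a = l := by
      intro a ha
      by_contra hal
      obtain ⟨s₁, s₂, rfl⟩ := List.append_of_mem ha
      have := h b a s₁ hbl hal (hK.factor ⟨s, s₂, by simp⟩ hu)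
      simp at hN
      omega
    rw [List.length_append, List.length_cons] at hN
    refine ⟨b, s.length, t.length, by omega, by omega, [], [], ?_⟩
    rw [← List.eq_replicate_of_mem hs, ← List.eq_replicate_of_mem ht]
    simp

/-- A factor `w` of an image is a factor of the image of a word of length at most `|w| + 1`. -/
theorem exists_short_preimage {f : A → List B} (hf : ∀ a, f a ≠ []) {w : List B} :
    ∀ (n : ℕ) (u : List A), u.length ≤ n → w <:+: u.flatMap f →
      ∃ v, v <:+: u ∧ v.length ≤ w.length + 1 ∧ w <:+: v.flatMap f := by
  intro n
  induction n with
  | zero =>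
    intro u hu hw
    exact ⟨u, List.infix_refl u, by omega, hw⟩
  | succ n ih =>
    intro u hu hw
    by_cases hlen : u.length ≤ w.length + 1
    · exact ⟨u, List.infix_refl u, hlen, hw⟩
    obtain ⟨a, u₁, rfl⟩ := List.exists_cons_of_ne_nil (l := u) (by rintro rfl; simp at hlen)
    rcases List.eq_nil_or_concat' u₁ with rfl | ⟨u₂, b, rfl⟩
    · simp at hlen
    obtain ⟨s, t, hst⟩ := hw
    simp only [List.length_cons, List.length_append, List.length_nil] at hu hlen
    by_cases hs : (f a).length ≤ s.length
    · obtain ⟨v, hv, h1, h2⟩ := ih (u₂ ++ [b]) (by simp; omega) (by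
        rw [List.flatMap_cons, List.append_assoc] at hst
        obtain ⟨r, hr⟩ := List.prefix_of_prefix_length_le ⟨_, rfl⟩ ⟨_, hst⟩ hs
        rw [← hr, List.append_assoc] at hst
        exact ⟨r, t, by rw [← List.append_cancel_left hst]; simp⟩)
      exact ⟨v, hv.trans ⟨[a], [], by simp⟩, h1, h2⟩
    by_cases ht : (f b).length ≤ t.length
    · obtain ⟨v, hv, h1, h2⟩ := ih (a :: u₂) (by simp; omega) (by
        have h3 : (a :: (u₂ ++ [b])).flatMap f = (a :: u₂).flatMap f ++ f b := by simp
        rw [h3] at hst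
        obtain ⟨r, hr⟩ := List.suffix_of_suffix_length_le ⟨_, rfl⟩ ⟨_, hst⟩ ht
        rw [← hr, ← List.append_assoc] at hst
        exact ⟨s, r, List.append_cancel_right hst⟩)
      exact ⟨v, hv.trans ⟨[], [b], by simp⟩, h1, h2⟩
    · exfalso
      have h1 := congrArg List.length hst
      have h2 := length_le_flatMap hf u₂
      simp only [List.length_append, List.flatMap_cons, List.flatMap_append, List.flatMap_nil,
        List.append_nil] at h1
      omega

theorem getElem_flatMap_replicate {f : A → List B} {l : A} {k i : ℕ}
    (h : i < ((List.replicate k l).flatMap f).length) :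
    ((List.replicate k l).flatMap f)[i]? = (f l)[i % (f l).length]? := by
  induction k generalizing i with
  | zero => simp at h
  | succ k ih =>
    simp only [List.replicate_succ, List.flatMap_cons, List.length_append] at h ⊢
    by_cases hi : i < (f l).length
    · rw [List.getElem?_append_left hi, Nat.mod_eq_of_lt hi]
    · rw [List.getElem?_append_right (by omega), ih (by omega),
        ← Nat.mod_eq_sub_mod (by omega)]

/-- At most `|f(l)|` factors of length `n` are read in the powers of `f(l)`, and every other one
overlaps the factor `f(b)` of some `f(l)ⁱ f(b) f(l)ʲ` with `b ≠ l`. -/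
theorem level_upper_bound [Fintype A] [DecidableEq A] {f : A → List B} (hf : ∀ a, f a ≠ [])
    {K : Set (List A)} (hK : IsLang K) {l : A} {n : ℕ} (h : Sparse l n K) :
    (level (Lang f K) n).ncard ≤
      (f l).length + ∑ b ∈ Finset.univ.erase l, (n + (f b).length) := by
  classical
  set P := (List.replicate (n + 1) l).flatMap f with hP
  have hlpos := List.length_pos_iff.2 (hf l)
  -- the word of length `n` read in the powers of `f l` from position `e`
  let per : ℕ → List B := fun e =>
    List.ofFn fun i : Fin n => (f l)[(e + i) % (f l).length]'(Nat.mod_lt _ hlpos)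
  have hper : ∀ k w, w.length = n → w <:+: (List.replicate k l).flatMap f →
      ∃ e < (f l).length, per e = w := by
    rintro k w hw ⟨s, t, hst⟩
    refine ⟨s.length % (f l).length, Nat.mod_lt _ hlpos, ?_⟩
    refine List.ext_getElem (by simp [per, hw]) fun i _ hi => ?_
    have h2 := congrArg List.length hst
    simp only [List.length_append] at h2
    have h3 := getElem_flatMap_replicate (f := f) (l := l) (k := k) (i := s.length + i)
      (by omega)
    rw [← hst, List.append_assoc, List.getElem?_append_right (by omega),
      Nat.add_sub_cancel_left, List.getElem?_append_left hi, List.getElem?_eq_getElem hi,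
      List.getElem?_eq_getElem (Nat.mod_lt _ hlpos), Option.some_inj] at h3
    simp only [per, List.getElem_ofFn, Nat.mod_add_mod]
    exact h3.symm
  let X : A → List B := fun b => P ++ f b ++ P
  let S : Finset (List B) := (Finset.range (f l).length).image per ∪
    (Finset.univ.erase l).biUnion fun b => (Finset.range (n + (f b).length)).image fun e =>
      ((X b).drop (P.length + 1 + e - n)).take n
  have hsub : level (Lang f K) n ⊆ S := by
    rintro w ⟨⟨u, hu, hwu⟩, hw⟩
    obtain ⟨v, hv, hvlen, hwv⟩ := exists_short_preimage hf _ u le_rfl hwu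
    rw [hw] at hvlen
    obtain ⟨b, i, j, hi, hj, hshape⟩ := h.shape hK (hK.factor hv hu) hvlen
    have hX : w <:+: X b := by
      refine (hwv.trans (infix_flatMap hshape f)).trans ?_
      obtain ⟨i', hi'⟩ := Nat.exists_eq_add_of_le hi
      obtain ⟨j', hj'⟩ := Nat.exists_eq_add_of_le hj
      refine ⟨(List.replicate i' l).flatMap f, (List.replicate j' l).flatMap f, ?_⟩
      have e1 : P = (List.replicate i' l).flatMap f ++ (List.replicate i l).flatMap f := by
        rw [hP, hi', add_comm, List.replicate_add, List.flatMap_append]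
      have e2 : P = (List.replicate j l).flatMap f ++ (List.replicate j' l).flatMap f := by
        rw [hP, hj', List.replicate_add, List.flatMap_append]
      have e3 : X b = ((List.replicate i' l).flatMap f ++ (List.replicate i l).flatMap f) ++ f b ++
          ((List.replicate j l).flatMap f ++ (List.replicate j' l).flatMap f) := by
        rw [← e1, ← e2]
      rw [e3]
      simp
    rw [Finset.mem_coe, Finset.mem_union]
    have hleft : ∀ k, w <:+: (List.replicate k l).flatMap f →
        w ∈ (Finset.range (f l).length).image per := by
      intro k hk
      obtain ⟨e, he, h1⟩ := hper k w hw hk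
      exact Finset.mem_image.2 ⟨e, Finset.mem_range.2 he, h1⟩
    by_cases hb : b = l
    · left
      refine hleft (n + 1 + 1 + (n + 1)) ?_
      rw [List.replicate_add, List.replicate_add, List.flatMap_append, List.flatMap_append]
      simpa [X, hb] using hX
    obtain ⟨s, t, hst⟩ := hX
    have hlen := congrArg List.length hst
    simp only [X, List.length_append] at hlen
    by_cases h1 : s.length + w.length ≤ P.length
    · left
      refine hleft (n + 1) ?_
      have h3 : s ++ w <+: P := List.prefix_of_prefix_length_le ⟨t, hst⟩
        ⟨f b ++ P, by simp [X]⟩ (by simpa using h1)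
      exact (List.suffix_append s w).isInfix.trans h3.isInfix
    by_cases h2 : P.length + (f b).length ≤ s.length
    · left
      refine hleft (n + 1) ?_
      have h3 : w ++ t <:+ P := List.suffix_of_suffix_length_le ⟨s, by rw [← List.append_assoc]; exact hst⟩
        ⟨P ++ f b, rfl⟩ (by simp; omega)
      exact (List.prefix_append w t).isInfix.trans h3.isInfix
    · right
      refine Finset.mem_biUnion.2 ⟨b, Finset.mem_erase.2 ⟨hb, Finset.mem_univ b⟩, ?_⟩
      refine Finset.mem_image.2 ⟨s.length + n - (P.length + 1), Finset.mem_range.2 (by omega), ?_⟩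
      have h3 : P.length + 1 + (s.length + n - (P.length + 1)) - n = s.length := by omega
      rw [h3, ← hst, List.append_assoc, List.drop_left, ← hw, List.take_left]
  calc (level (Lang f K) n).ncard ≤ (S : Set (List B)).ncard :=
        Set.ncard_le_ncard hsub S.finite_toSet
    _ = S.card := Set.ncard_coe_finset S
    _ ≤ _ := by
      refine (Finset.card_union_le _ _).trans (Nat.add_le_add ?_ ?_)
      · simpa using Finset.card_image_le (s := Finset.range (f l).length) (f := per)
      · refine Finset.card_biUnion_le.trans (Finset.sum_le_sum fun b _ => ?_)
        exact Finset.card_image_le.trans (by simp)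

/-! ### Dendric preserving families of words -/

theorem letterImage_arL (l : A) : letterImage (arL l) = lMap l := by
  funext a
  simp only [letterImage, arL, lMap, FreeMonoid.lift_eval_of]
  split_ifs <;> rfl

theorem letterImage_arR (l : A) : letterImage (arR l) = rMap l := by
  funext a
  simp only [letterImage, arR, rMap, FreeMonoid.lift_eval_of]
  split_ifs <;> rfl

theorem IsDendricLanguage.isLang {K : Set (List A)} (h : IsDendricLanguage K) : IsLang K := by
  obtain ⟨x, -, -, rfl⟩ := h
  exact language_isLang x

theorem IsDendricLanguage.mem {K : Set (List A)} (h : IsDendricLanguage K) (a : A) :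
    [a] ∈ K := by
  obtain ⟨x, hx, -, rfl⟩ := h
  exact isOver_iff.1 hx a

theorem IsDendricLanguage.Lang_lMap [Finite A] {K : Set (List A)} (h : IsDendricLanguage K)
    (l : A) : IsDendricLanguage (Lang (lMap l) K) := by
  obtain ⟨x, hx, hd, rfl⟩ := h
  have hne : NonErasing (arL l) := by
    intro a ha
    have h1 : letterImage (arL l) a = [] := by simp [letterImage, ha]
    rw [letterImage_arL] at h1
    exact lMap_ne_nil l a h1
  have h1 := language_wordImage (arL l) hne x
  rw [letterImage_arL] at h1
  refine ⟨wordImage (arL l) hne x, ?_, ?_, h1.symm⟩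
  · rw [isOver_iff, h1]
    exact fun a => singleton_mem_Lang (isOver_iff.1 hx a) (mem_lMap l a)
  · rw [isDendric_iff, h1]
    exact dendricL_Lang_lMap (language_isLang x) (isOver_iff.1 hx l) ((isDendric_iff x).1 hd)

theorem exists_sparse [Finite A] [Nontrivial A] (l : A) (N : ℕ) :
    ∃ K : Set (List A), IsDendricLanguage K ∧ Sparse l N K := by
  induction N with
  | zero =>
    obtain ⟨K, hK, -⟩ := exists_dendric_star l
    exact ⟨K, hK, fun _ _ _ _ _ _ => Nat.zero_le _⟩
  | succ N ih =>
    obtain ⟨K, hK, h⟩ := ih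
    exact ⟨_, hK.Lang_lMap l, h.Lang_lMap hK.isLang⟩

/-- The morphism `a ↦ f a` is non-erasing, its images contain all the letters of `B`, and it maps
the dendric words over `A` to dendric words. -/
structure Preserving (f : A → List B) : Prop where
  ne_nil : ∀ a, f a ≠ []
  surj : ∀ b, ∃ a, b ∈ f a
  dendric : ∀ K, IsDendricLanguage K → DendricL (Lang f K)

theorem Preserving.isLang {f : A → List B} (hf : Preserving f) {K : Set (List A)}
    (hK : IsDendricLanguage K) : IsLang (Lang f K) :=
  Lang_isLang hf.ne_nil hK.isLang

theorem Preserving.mem {f : A → List B} (hf : Preserving f) {K : Set (List A)}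
    (hK : IsDendricLanguage K) (b : B) : [b] ∈ Lang f K := by
  obtain ⟨a, ha⟩ := hf.surj b
  exact singleton_mem_Lang (hK.mem a) ha

/-- The complexity `(|B| - 1) n + 1` of the image is bounded by counting the factors of the
words `f(l)ⁱ f(b) f(l)ʲ`, which occur when `l` has large powers in the argument. -/
theorem Preserving.card_le [Finite A] [Nontrivial A] [Finite B] [Nonempty B] {f : A → List B}
    (hf : Preserving f) : Nat.card B ≤ Nat.card A := by
  classical
  have := Fintype.ofFinite A
  by_contra hcon
  obtain ⟨l⟩ : Nonempty A := inferInstance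
  set C := (f l).length + ∑ b ∈ Finset.univ.erase l, (f b).length with hC
  obtain ⟨K, hK, hs⟩ := exists_sparse l C
  have h1 := level_lower_bound (hf.isLang hK) (hf.dendric K hK) (hf.mem hK) C
  have h2 := level_upper_bound hf.ne_nil hK.isLang hs
  rw [Finset.sum_add_distrib, Finset.sum_const, smul_eq_mul, Finset.card_erase_of_mem
    (Finset.mem_univ l), Finset.card_univ, ← Nat.card_eq_fintype_card] at h2
  have hA : 1 ≤ Nat.card A := Nat.card_pos
  obtain ⟨k, hk⟩ := Nat.exists_eq_add_of_le' hA
  have h3 : C * (k + 1 + 1) ≤ C * Nat.card B := Nat.mul_le_mul_left C (by omega)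
  rw [hk, Nat.add_sub_cancel] at h2
  have h4 : C * (k + 1 + 1) = k * C + C + C := by ring
  omega

/-! ### Rotating a dendric preserving morphism -/

/-- A word with period `n` which contains `vc` and `vd`, where `v` has length `n`. -/
theorem eq_of_periodic {t x y v : List B} {c d : B} (h : t ++ x = y ++ t) (hy : y ≠ [])
    (hv : v.length = y.length) (hc : v ++ [c] <:+: t) (hd : v ++ [d] <:+: t) : c = d := by
  have key : ∀ e, v ++ [e] <:+: t → some e = v[0]? := by
    rintro e ⟨s, r, hsr⟩
    have hpos := List.length_pos_iff.2 hy
    have hlen := congrArg List.length hsr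
    simp only [List.length_append, List.length_singleton] at hlen
    have h1 : (t ++ x)[s.length + v.length]? = (y ++ t)[s.length + v.length]? := by rw [h]
    rw [List.getElem?_append_left (by omega), List.getElem?_append_right (by omega),
      show s.length + v.length - y.length = s.length by omega] at h1
    have h2 : t[s.length + v.length]? = some e := by
      rw [← hsr, show s ++ (v ++ [e]) ++ r = (s ++ v) ++ e :: r by simp, ← List.length_append,
        List.getElem?_append_right le_rfl]
      simp
    have h3 : t[s.length]? = v[0]? := by
      rw [← hsr, show s ++ (v ++ [e]) ++ r = s ++ (v ++ e :: r) by simp,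
        List.getElem?_append_right le_rfl, Nat.sub_self, List.getElem?_append_left (by omega)]
    rw [← h2, h1, h3]
  exact Option.some_injective _ ((key c hc).trans (key d hd).symm)

/-- A dendric language over at least two letters has right special words of every length. -/
theorem exists_right_special [Nontrivial B] {K : Set (List B)} (hK : IsLang K) (hd : DendricL K)
    (hall : ∀ b, [b] ∈ K) (n : ℕ) :
    ∃ v c d, v.length = n ∧ c ≠ d ∧ v ++ [c] ∈ K ∧ v ++ [d] ∈ K := by
  by_contra! hcon
  obtain ⟨b, b', hb⟩ := exists_pair_ne B
  apply hb
  clear hb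
  induction right_chain_level hK hd hall n b b' with
  | refl => rfl
  | tail _ hcd ih =>
    obtain ⟨v, hv, h1, h2⟩ := hcd
    rw [ih]
    by_contra hne
    exact hcon v _ _ hv hne h1 h2

theorem exists_dendricLanguage (A : Type*) [Finite A] [Nontrivial A] :
    ∃ K : Set (List A), IsDendricLanguage K :=
  (exists_dendric_star (Classical.arbitrary A)).imp fun _ h => h.1

/-- The words through which a dendric preserving morphism has conjugates are bounded: otherwise
its images would be periodic. -/
theorem Preserving.conjBy_bounded [Finite A] [Nontrivial A] [Nontrivial B] {f : A → List B}
    (hf : Preserving f) : ∃ M, (∀ t g, ConjBy t f g → t.length < M) ∧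
      ∀ t g, ConjBy t g f → t.length < M := by
  obtain ⟨K, hK⟩ := exists_dendricLanguage A
  obtain ⟨a₀⟩ : Nonempty A := inferInstance
  obtain ⟨v, c, d, hv, hcd, ⟨u, -, hc⟩, ⟨w, -, hd⟩⟩ := exists_right_special (hf.isLang hK)
    (hf.dendric K hK) (hf.mem hK) (f a₀).length
  refine ⟨(u.flatMap f).length + (w.flatMap f).length, fun t g h => ?_, fun t g h => ?_⟩
  · by_contra! hM
    refine hcd (eq_of_periodic (h a₀) (h.ne_nil hf.ne_nil a₀) (by rw [hv, h.length_eq]) ?_ ?_)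
    · exact hc.trans (List.suffix_of_suffix_length_le ⟨t, h.flatMap u⟩ ⟨_, rfl⟩
        (by omega)).isInfix
    · exact hd.trans (List.suffix_of_suffix_length_le ⟨t, h.flatMap w⟩ ⟨_, rfl⟩
        (by omega)).isInfix
  · by_contra! hM
    refine hcd (eq_of_periodic (h a₀) (hf.ne_nil a₀) hv ?_ ?_)
    · exact hc.trans (List.prefix_of_prefix_length_le ⟨t, (h.flatMap u).symm⟩ ⟨_, rfl⟩
        (by omega)).isInfix
    · exact hd.trans (List.prefix_of_prefix_length_le ⟨t, (h.flatMap w).symm⟩ ⟨_, rfl⟩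
        (by omega)).isInfix

/-- As long as all the images end with the same letter, this letter can be moved to the front. -/
theorem Preserving.exists_conj_last [Finite A] [Nontrivial A] [Nontrivial B] {f : A → List B}
    (hf : Preserving f) : ∃ t g, ConjBy t f g ∧ ¬ ∃ c, ∀ a, ∃ r, g a = r ++ [c] := by
  by_contra! hcon
  obtain ⟨M, hM, -⟩ := hf.conjBy_bounded
  have key : ∀ n : ℕ, ∃ t g, ConjBy t f g ∧ t.length = n := by
    intro n
    induction n with
    | zero => exact ⟨[], f, fun a => by simp, rfl⟩
    | succ n ih =>
      obtain ⟨t, g, h, hn⟩ := ih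
      obtain ⟨c, hc⟩ := hcon t g h
      choose r hr using hc
      refine ⟨c :: t, fun a => c :: r a, fun a => ?_, by simp [hn]⟩
      rw [List.cons_append, h a, hr a]
      simp
  obtain ⟨t, g, h, hn⟩ := key M
  exact absurd (hM t g h) (by omega)

theorem Preserving.exists_conj_first [Finite A] [Nontrivial A] [Nontrivial B] {f : A → List B}
    (hf : Preserving f) : ∃ s g, ConjBy s g f ∧ ¬ ∃ c, ∀ a, ∃ r, g a = c :: r := by
  by_contra! hcon
  obtain ⟨M, -, hM⟩ := hf.conjBy_bounded
  have key : ∀ n : ℕ, ∃ t g, ConjBy t g f ∧ t.length = n := by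
    intro n
    induction n with
    | zero => exact ⟨[], f, fun a => by simp, rfl⟩
    | succ n ih =>
      obtain ⟨t, g, h, hn⟩ := ih
      obtain ⟨c, hc⟩ := hcon t g h
      choose r hr using hc
      refine ⟨t ++ [c], fun a => r a ++ [c], fun a => ?_, by simp [hn]⟩
      have := h a
      rw [hr a] at this
      rw [← List.append_assoc (f a), ← this]
      simp
  obtain ⟨t, g, h, hn⟩ := key M
  exact absurd (hM t g h) (by omega)

theorem exists_mem_of_singleton_mem_Lang {f : A → List B} {K : Set (List A)} {b : B}
    (h : [b] ∈ Lang f K) : ∃ a, b ∈ f a := by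
  obtain ⟨u, -, hu⟩ := h
  obtain ⟨a, -, ha⟩ := List.mem_flatMap.1 (hu.subset (List.mem_singleton_self b))
  exact ⟨a, ha⟩

theorem Preserving.conj [Finite A] [Nontrivial A] {f g : A → List B} {t : List B}
    (hf : Preserving f) (h : ConjBy t f g) : Preserving g where
  ne_nil := h.ne_nil hf.ne_nil
  surj b := by
    obtain ⟨K, hK⟩ := exists_dendricLanguage A
    have := hf.mem hK b
    rw [h.Lang_eq hf.ne_nil hK.isLang] at this
    exact exists_mem_of_singleton_mem_Lang this
  dendric K hK := by
    rw [← h.Lang_eq hf.ne_nil hK.isLang]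
    exact hf.dendric K hK

/-! ### First and last letters -/

/-- If the extension graphs of the empty words of all the dendric words are sent into trees by
identifying their left vertices according to `G` and their right vertices according to `F`, and if
neither map is constant, then both are injective. -/
theorem injective_of_relTree [Finite A] {F G : A → B}
    (H : ∀ K : Set (List A), IsDendricLanguage K →
      ∃ R : Set (B × B), RelTree R ∧ ∀ a b, [a, b] ∈ K → (G a, F b) ∈ R)
    (hF : ∀ c, ∃ a, F a ≠ c) (hG : ∀ c, ∃ a, G a ≠ c) :
    Function.Injective F ∧ Function.Injective G := by
  constructor
  · have step : ∀ a b c, F a = F b → a ≠ b → F c ≠ F a → G a = G c := by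
      intro a b c hab hne hc
      obtain ⟨⟨K, hK, h1, h2, h3, h4⟩, -⟩ := exists_dendric_insert (a := a) (b := b) (c := c) hne
        (by rintro rfl; exact hc rfl) (by rintro rfl; exact hc hab.symm)
      obtain ⟨R, hR, hsub⟩ := H K hK
      have h5 := hsub _ _ h4
      rw [← hab] at h5
      by_contra hG
      exact hc (hR.no_square h5 (hsub _ _ h1) (hsub _ _ h2) (hsub _ _ h3) hG).symm
    intro a b hab
    by_contra hne
    obtain ⟨c, hc⟩ := hF (F a)
    obtain ⟨e, he⟩ := hG (G c)
    apply he
    by_cases hea : F e = F a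
    · by_cases h : e = a
      · rw [h]; exact step a b c hab hne hc
      · exact step e a c hea h (by rw [hea]; exact hc)
    · rw [← step a b e hab hne hea]
      exact step a b c hab hne hc
  · have step : ∀ a b c, G a = G b → a ≠ b → G c ≠ G a → F a = F c := by
      intro a b c hab hne hc
      obtain ⟨-, K, hK, h1, h2, h3, h4⟩ := exists_dendric_insert (a := a) (b := b) (c := c) hne
        (by rintro rfl; exact hc rfl) (by rintro rfl; exact hc hab.symm)
      obtain ⟨R, hR, hsub⟩ := H K hK
      have h5 := hsub _ _ h4
      rw [← hab] at h5
      exact hR.no_square h5 (hsub _ _ h1) (hsub _ _ h2) (hsub _ _ h3) hc.symm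
    intro a b hab
    by_contra hne
    obtain ⟨c, hc⟩ := hG (G a)
    obtain ⟨e, he⟩ := hF (F c)
    apply he
    by_cases hea : G e = G a
    · by_cases h : e = a
      · rw [h]; exact step a b c hab hne hc
      · exact step e a c hea h (by rw [hea]; exact hc)
    · rw [← step a b e hab hne hea]
      exact step a b c hab hne hc

theorem isChain_of_infix {R : B → B → Prop} {w : List B} (h : ∀ p q, [p, q] <:+: w → R p q) :
    List.IsChain R w := by
  induction w with
  | nil => exact .nil
  | cons a w ih =>
    cases w with
    | nil => exact .singleton a
    | cons b w =>
      refine .cons_cons (h a b ⟨[], w, rfl⟩) (ih fun p q hpq => h p q ?_)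
      exact hpq.trans ⟨[a], [], by simp⟩

theorem mem_eq_of_isChain_eq {c : B} {w : List B} (h : List.IsChain (fun p q => p = c → q = c)
    (c :: w)) : ∀ x ∈ c :: w, x = c := by
  induction w with
  | nil => simp
  | cons b w ih =>
    rw [List.isChain_cons_cons] at h
    obtain rfl := h.1 rfl
    intro x hx
    rcases List.mem_cons.1 hx with rfl | hx
    · rfl
    · exact ih h.2 x hx

/-- Over two letters, an alternating word is determined by its length and its first letter. -/
theorem prefix_of_isChain_ne (h2 : ∀ x y z : B, x ≠ y → y ≠ z → x = z) {u v : List B} {c : B}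
    (hu : List.IsChain (· ≠ ·) (c :: u)) (hv : List.IsChain (· ≠ ·) (c :: v))
    (h : u.length ≤ v.length) : u <+: v := by
  induction u generalizing c v with
  | nil => exact List.nil_prefix
  | cons a u ih =>
    cases v with
    | nil => simp at h
    | cons b v =>
      rw [List.isChain_cons_cons] at hu hv
      obtain rfl : a = b := h2 a c b hu.1.symm hv.1
      rw [List.prefix_cons_inj]
      exact ih hu.2 hv.2 (by simpa using h)

/-- Over two letters, the images of a dendric preserving morphism cannot alternate: the word
`f(b)` has the four extensions given by `bbb`, `abb`, `bba` and by the inside of `bab`. -/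
theorem Preserving.not_alternating [Finite A] [Nontrivial A] {f : A → List B} (hf : Preserving f)
    {F G : A → B} {f₀ g₀ : A → List B} (hF : ∀ a, f a = F a :: f₀ a)
    (hG : ∀ a, f a = g₀ a ++ [G a]) {a b : A} (hFab : F a ≠ F b) (ha : F a = G a) (hb : F b = G b)
    (htwo : ∀ x y z : B, x ≠ y → y ≠ z → x = z)
    (hca : List.IsChain (· ≠ ·) (f a)) (hcb : List.IsChain (· ≠ ·) (f b))
    (hlen : 3 ≤ (f a).length + (f b).length) : False := by
  obtain ⟨K₀, hK₀, hstar⟩ := exists_dendric_star b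
  set K₁ := Lang (lMap b) K₀ with hK₁
  have hab : a ≠ b := fun h => hFab (by rw [h])
  have hL₀ := hK₀.isLang
  have hL₁ : IsLang K₁ := (hK₀.Lang_lMap b).isLang
  have hd₁ := (hK₀.Lang_lMap b).Lang_lMap b
  have hR := hf.dendric _ hd₁
  have hL := hf.isLang hd₁
  have hK₁pairs := pair_mem_Lang_lMap hL₀ (hK₀.mem a) (hK₀.mem b)
  have hbb : [b, b] ∈ K₁ := self_self_mem_Lang_lMap hL₀ (hK₀.mem b)
  have hbbb : [b, b, b] ∈ Lang (lMap b) K₁ := by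
    obtain ⟨c, hc⟩ := hL₁.append_singleton hbb
    obtain ⟨t, ht⟩ := lMap_eq_cons b c
    exact ⟨_, hc, [], t, by simp [ht]⟩
  have hbba : [b, b, a] ∈ Lang (lMap b) K₁ := ⟨_, hK₁pairs.2, [], [], by simp [lMap_of_ne hab]⟩
  have habb : [a, b, b] ∈ Lang (lMap b) K₁ := by
    obtain ⟨c, hc⟩ := hL₁.append_singleton hK₁pairs.1
    obtain ⟨t, ht⟩ := lMap_eq_cons b c
    exact ⟨_, hc, [b], t, by simp [ht, lMap_of_ne hab]⟩
  have hbab : [b, a, b] ∈ Lang (lMap b) K₁ :=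
    ⟨_, hK₁pairs.1, [], [], by simp [lMap_of_ne hab]⟩
  have hext : ∀ x y, [x, b, y] ∈ Lang (lMap b) K₁ →
      (G x, F y) ∈ biE (Lang f (Lang (lMap b) K₁)) (f b) := by
    intro x y h
    refine ⟨_, h, g₀ x, f₀ y, ?_⟩
    simp [hG x, hF y]
  have hlast : (G a, F a) ∈ biE (Lang f (Lang (lMap b) K₁)) (f b) := by
    have h1 : List.IsChain (· ≠ ·) (F b :: (G a :: (f b ++ [F a]))) := by
      refine .cons_cons (by rw [← ha]; exact hFab.symm) ?_
      rw [hF b, List.cons_append]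
      refine .cons_cons (by rw [← ha]; exact hFab) ?_
      rw [← List.cons_append, ← hF b, List.isChain_append]
      refine ⟨hcb, .singleton _, ?_⟩
      rw [hG b]
      simp only [List.getLast?_append, List.getLast?_singleton, Option.some_or, Option.mem_def,
        Option.some.injEq, List.head?_cons]
      rintro x rfl y rfl
      rw [← hb]
      exact hFab.symm
    have h2 : List.IsChain (· ≠ ·) (F b :: (f₀ b ++ f a ++ f b)) := by
      have : F b :: (f₀ b ++ f a ++ f b) = f b ++ (f a ++ f b) := by rw [hF b]; simp
      rw [this, List.isChain_append, List.isChain_append]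
      refine ⟨hcb, ⟨hca, hcb, ?_⟩, ?_⟩
      · rw [hG a, hF b]
        simp only [List.getLast?_append, List.getLast?_singleton, Option.some_or, Option.mem_def,
          Option.some.injEq, List.head?_cons]
        rintro x rfl y rfl
        rw [← ha]
        exact hFab
      · rw [hF a, hG b]
        simp only [List.getLast?_append, List.getLast?_singleton, Option.some_or, Option.mem_def,
          Option.some.injEq, List.head?_cons, List.cons_append]
        rintro x rfl y rfl
        rw [← hb]
        exact hFab.symm
    have h3 := prefix_of_isChain_ne htwo h1 h2 (by
      have h4 : (f b).length = (f₀ b).length + 1 := by rw [hF b]; simp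
      simp only [List.length_cons, List.length_append, List.length_nil]
      omega)
    have h4 : [b, a, b].flatMap f = [F b] ++ (f₀ b ++ f a ++ f b) := by
      simp [hF b]
    refine ⟨_, hbab, h3.isInfix.trans ?_⟩
    rw [h4]
    exact (List.suffix_append _ _).isInfix
  have hGab : G a ≠ G b := by rw [← ha, ← hb]; exact hFab
  have hmem : f b ∈ Lang f (Lang (lMap b) K₁) := by
    rw [← List.append_nil (f b)]
    exact flatMap_mem_Lang (u := [b]) (hd₁.mem b)
  exact hFab ((hR _ hmem).no_square hlast (hext b a hbba) (hext a b habb) (hext b b hbbb) hGab)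

/-- If the first letters are pairwise distinct, and so are the last letters, then the images are
letters. -/
theorem Preserving.length_eq_one [Finite A] [Nontrivial A] {f : A → List B} (hf : Preserving f)
    {F G : A → B} {f₀ g₀ : A → List B} (hF : ∀ a, f a = F a :: f₀ a)
    (hG : ∀ a, f a = g₀ a ++ [G a]) (hFb : Function.Bijective F) (hGb : Function.Bijective G)
    (a : A) : f a = [F a] := by
  -- all the double stars contain the pairs of consecutive letters of the images
  have hint : ∀ e p q, [p, q] <:+: f e →
      ∃ a b, p = G a ∧ q = F b ∧ a ≠ b ∧ ∀ l, l = a ∨ l = b := by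
    intro e p q hpq
    obtain ⟨a, rfl⟩ := hGb.2 p
    obtain ⟨b, rfl⟩ := hFb.2 q
    have hl : ∀ l, l = a ∨ l = b := by
      intro l
      obtain ⟨K, hK, hstar⟩ := exists_dendric_star l
      have hR := hf.dendric K hK _ (hf.isLang hK).nil_mem
      have hpair : ∀ x y, [x, y] ∈ K → (G x, F y) ∈ biE (Lang f K) [] := by
        intro x y h
        exact ⟨_, h, g₀ x, f₀ y, by simp [hG x, hF y]⟩
      have h1 : (G a, F b) ∈ biE (Lang f K) [] :=
        ⟨_, hK.mem e, by simpa using hpq⟩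
      by_contra! hcon
      exact hcon.2 (hFb.1 (hR.no_square (hpair _ _ (hstar l).1) (hpair _ _ (hstar a).1)
        (hpair _ _ (hstar b).2) h1 (fun h => hcon.1 (hGb.1 h))))
    refine ⟨a, b, rfl, rfl, ?_, hl⟩
    rintro rfl
    obtain ⟨x, hx⟩ := exists_ne a
    exact hx ((hl x).elim id id)
  by_contra hcon
  obtain ⟨q, r, hqr⟩ : ∃ q r, f₀ a = q :: r := by
    apply List.exists_cons_of_ne_nil
    intro h
    exact hcon (by rw [hF a, h])
  obtain ⟨x, y, -, -, hxy, hall⟩ := hint a (F a) q ⟨[], r, by rw [hF a, hqr]; simp⟩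
  have hGxy : G x ≠ G y := fun h => hxy (hGb.1 h)
  have hFxy : F x ≠ F y := fun h => hxy (hFb.1 h)
  have hBall : ∀ z, z = G x ∨ z = G y := by
    intro z
    obtain ⟨l, rfl⟩ := hGb.2 z
    exact (hall l).imp (congrArg G) (congrArg G)
  rcases hBall (F x) with h | h
  · have h' : F y = G y := (hBall (F y)).resolve_left fun h1 => hFxy (h.trans h1.symm)
    have hFG : ∀ e, F e = G e := fun e => by rcases hall e with rfl | rfl <;> assumption
    have hchain : ∀ e, List.IsChain (· ≠ ·) (f e) := by
      intro e
      refine isChain_of_infix fun p q hpq => ?_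
      obtain ⟨c, d, rfl, rfl, hcd, -⟩ := hint e p q hpq
      rw [hFG]
      exact fun h => hcd (hGb.1 h)
    refine hf.not_alternating hF hG hFxy h h' ?_ (hchain x) (hchain y) ?_
    · intro u v w huv hvw
      rcases hBall u with rfl | rfl <;> rcases hBall v with rfl | rfl <;>
        rcases hBall w with rfl | rfl <;> first | rfl | exact absurd rfl huv | exact absurd rfl hvw
    · have h1 := List.length_pos_iff.2 (hf.ne_nil x)
      have h2 := List.length_pos_iff.2 (hf.ne_nil y)
      have h3 : 2 ≤ (f a).length := by rw [hF a, hqr]; simp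
      rcases hall a with rfl | rfl <;> omega
  · -- the images would be powers of letters, but their first and last letters are distinct
    have h' : F y = G x := (hBall (F y)).resolve_right fun h1 => hFxy (h.trans h1.symm)
    have hconst : ∀ z ∈ F x :: f₀ x, z = F x := by
      apply mem_eq_of_isChain_eq
      rw [← hF x]
      refine isChain_of_infix fun p q hpq => ?_
      obtain ⟨c, d, rfl, rfl, hcd, -⟩ := hint x p q hpq
      intro h1
      rw [← h1]
      rcases hall c with rfl | rfl <;> rcases hall d with rfl | rfl
      · exact absurd rfl hcd
      · exact h'
      · exact h
      · exact absurd rfl hcd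
    have h1 : G x = F x := hconst (G x) (by rw [← hF x, hG x]; simp)
    exact hGxy (h1.trans h)

/-! ### Factoring out an Arnoux-Rauzy morphism -/

theorem exists_flatMap_lMap {l : A} : ∀ (n : ℕ) (w : List A), w.length ≤ n →
    (∀ c t, w = c :: t → c = l) → (∀ p q, [p, q] <:+: w → p = l ∨ q = l) →
    ∃ u : List A, u.flatMap (lMap l) = w := by
  intro n
  induction n with
  | zero =>
    intro w hw _ _
    exact ⟨[], (List.length_eq_zero_iff.1 (Nat.le_zero.1 hw)).symm⟩
  | succ n ih =>
    intro w hw hfirst hpair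
    match w with
    | [] => exact ⟨[], rfl⟩
    | [c] => exact ⟨[l], by simp [hfirst c [] rfl]⟩
    | c :: d :: w =>
      obtain rfl := hfirst c _ rfl
      by_cases hd : d = c
      · subst hd
        obtain ⟨u, hu⟩ := ih (d :: w) (by simpa using hw) (fun _ _ h => (List.cons.inj h).1.symm)
          fun p q h => hpair p q (h.trans (List.suffix_cons _ _).isInfix)
        exact ⟨d :: u, by simp [hu]⟩
      · obtain ⟨u, hu⟩ := ih w (by simp at hw; omega)
          (by
            rintro e t rfl
            exact (hpair d e ⟨[c], t, rfl⟩).resolve_left hd)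
          fun p q h => hpair p q (h.trans ⟨[c, d], [], by simp⟩)
        exact ⟨d :: u, by simp [hu, lMap_of_ne hd]⟩

@[simp] theorem rMap_self (l : A) : rMap l l = [l] := by simp [rMap]

theorem rMap_of_ne {l a : A} (h : a ≠ l) : rMap l a = [a, l] := by simp [rMap, h]

theorem exists_flatMap_rMap {l : A} : ∀ (n : ℕ) (w : List A), w.length ≤ n →
    (∀ c t, w = t ++ [c] → c = l) → (∀ p q, [p, q] <:+: w → p = l ∨ q = l) →
    ∃ u : List A, u.flatMap (rMap l) = w := by
  intro n
  induction n with
  | zero =>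
    intro w hw _ _
    exact ⟨[], (List.length_eq_zero_iff.1 (Nat.le_zero.1 hw)).symm⟩
  | succ n ih =>
    intro w hw hlast hpair
    match w with
    | [] => exact ⟨[], rfl⟩
    | [c] => exact ⟨[l], by simp [hlast c [] rfl]⟩
    | c :: d :: w =>
      by_cases hc : c = l
      · subst hc
        obtain ⟨u, hu⟩ := ih (d :: w) (by simpa using hw)
          (fun e t h => hlast e (c :: t) (by rw [h]; rfl))
          fun p q h => hpair p q (h.trans (List.suffix_cons _ _).isInfix)
        exact ⟨c :: u, by simp [hu]⟩
      · obtain rfl := (hpair c d ⟨[], w, rfl⟩).resolve_left hc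
        obtain ⟨u, hu⟩ := ih w (by simp at hw; omega)
          (fun e t h => hlast e (c :: d :: t) (by rw [h]; rfl))
          fun p q h => hpair p q (h.trans ⟨[c, d], [], by simp⟩)
        exact ⟨c :: u, by simp [hu, rMap_of_ne hc]⟩

/-- The right factor of a dendric preserving morphism `L_l ∘ f'` or `R_l ∘ f'` is dendric
preserving. The letter `l` occurs in the images under `f'` because `ll` occurs in those under
`L_l ∘ f'`. -/
theorem Preserving.of_comp [Finite A] [Nontrivial A] [Nontrivial B] {f f' : A → List B} {l : B}
    {m : B → List B} (hm : m = lMap l ∨ m = rMap l) (hf : Preserving f)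
    (h : ∀ a, f a = (f' a).flatMap m) (hll : ∀ K, IsDendricLanguage K → [l, l] ∈ Lang f K) :
    Preserving f' := by
  have hne : ∀ a, f' a ≠ [] := by
    intro a ha
    apply hf.ne_nil a
    rw [h, ha]
    rfl
  have hLang : ∀ K, IsDendricLanguage K → Lang f K = Lang (lMap l) (Lang f' K) := by
    intro K hK
    obtain rfl : f = fun a => (f' a).flatMap m := funext h
    rw [Lang_comp]
    rcases hm with rfl | rfl
    · rfl
    · exact Lang_rMap (Lang_isLang hne hK.isLang) l
  refine ⟨hne, fun b => ?_, fun K hK => ?_⟩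
  · obtain ⟨K, hK⟩ := exists_dendricLanguage A
    by_cases hb : b = l
    · subst hb
      have h1 := hll K hK
      rw [hLang K hK] at h1
      obtain ⟨u, hu, s, t, hst⟩ := h1
      have h2 : s ++ b :: (b :: t) = u.flatMap (lMap b) := by rw [← hst]; simp
      obtain ⟨u₁, u₂, rfl, -, h3⟩ := decode_lMap h2
      obtain ⟨u₃, rfl⟩ := first_of_flatMap_lMap h3
      exact exists_mem_of_singleton_mem_Lang (Lang_factor ⟨u₁, u₃, by simp⟩ hu)
    · obtain ⟨a, ha⟩ := hf.surj b
      rw [h, List.mem_flatMap] at ha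
      obtain ⟨c, hc, hbc⟩ := ha
      refine ⟨a, ?_⟩
      have : b = c := by
        by_cases hcl : c = l
        · rcases hm with rfl | rfl <;> simp [hcl] at hbc <;> exact absurd hbc hb
        · rcases hm with rfl | rfl
          · simpa [lMap_of_ne hcl, hb] using hbc
          · simpa [rMap_of_ne hcl, hb] using hbc
      rwa [this]
  · refine dendricL_of_Lang_lMap (Lang_isLang hne hK.isLang) (l := l) ?_
    rw [← hLang K hK]
    exact hf.dendric K hK

theorem sum_length_lt [Fintype A] [Nontrivial B] {f f' : A → List B} {l : B} {m : B → List B}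
    (hm : m = lMap l ∨ m = rMap l) (hf : ∀ b, ∃ a, b ∈ f' a)
    (h : ∀ a, f a = (f' a).flatMap m) :
    ∑ a, (f' a).length < ∑ a, (f a).length := by
  have hne : ∀ b, m b ≠ [] := by
    rcases hm with rfl | rfl
    · exact lMap_ne_nil l
    · exact rMap_ne_nil l
  obtain ⟨b, hb⟩ := exists_ne l
  obtain ⟨a, ha⟩ := hf b
  refine Finset.sum_lt_sum (fun a _ => ?_) ⟨a, Finset.mem_univ a, ?_⟩
  · rw [h]; exact length_le_flatMap hne _
  · obtain ⟨s, t, hst⟩ := List.append_of_mem ha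
    have h1 := length_le_flatMap hne s
    have h2 := length_le_flatMap hne t
    have h3 : (m b).length = 2 := by
      rcases hm with rfl | rfl
      · simp [lMap_of_ne hb]
      · simp [rMap_of_ne hb]
    rw [h, hst]
    simp only [List.flatMap_append, List.flatMap_cons, List.length_append, List.length_cons, h3]
    omega

/-- A dendric preserving morphism is a bijective coding, or one can factor out an Arnoux-Rauzy
morphism on the left. -/
theorem Preserving.coding_or_comp [Finite A] [Finite B] [Nontrivial A] [Nontrivial B]
    {f : A → List B} (hf : Preserving f) :
    (∃ F : A → B, Function.Injective F ∧ ∀ a, f a = [F a]) ∨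
    ∃ (l : B) (m : B → List B) (f' : A → List B), (m = lMap l ∨ m = rMap l) ∧ Preserving f' ∧
      ∀ a, f a = (f' a).flatMap m := by
  obtain ⟨t, g, htg, hg⟩ := hf.exists_conj_last
  have hgP := hf.conj htg
  obtain ⟨s, f₁, hsf, hf₁⟩ := hgP.exists_conj_first
  have hne₁ := hsf.ne_nil' hgP.ne_nil
  have hLang : ∀ K, IsDendricLanguage K → Lang f K = Lang g K := fun K hK =>
    htg.Lang_eq hf.ne_nil hK.isLang
  have hLang₁ : ∀ K, IsDendricLanguage K → Lang f₁ K = Lang f K := fun K hK => by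
    rw [hLang K hK]; exact hsf.Lang_eq hne₁ hK.isLang
  choose F f₀ hF using fun a => List.exists_cons_of_ne_nil (hne₁ a)
  choose g₀ G hG using fun a => (List.eq_nil_or_concat' (g a)).resolve_left (hgP.ne_nil a)
  have hpair : ∀ K, IsDendricLanguage K → ∀ a b, [a, b] ∈ K → (G a, F b) ∈ biE (Lang f K) s := by
    intro K hK a b hab
    have h1 := hsf.append_mem hne₁ hK.isLang hab
    rw [hLang₁ K hK] at h1
    refine Lang_factor ?_ h1
    have h2 : s ++ [a, b].flatMap f₁ = g₀ a ++ ([G a] ++ s ++ [F b]) ++ f₀ b := by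
      have h3 : s ++ [a, b].flatMap f₁ = (s ++ f₁ a) ++ f₁ b := by simp
      rw [h3, hsf a, hG, hF]
      simp
    rw [h2]
    exact ⟨g₀ a, f₀ b, by simp⟩
  have hs : ∀ K, IsDendricLanguage K → s ∈ Lang f K := by
    intro K hK
    have h1 := hsf.append_mem hne₁ hK.isLang hK.isLang.nil_mem
    rw [hLang₁ K hK] at h1
    simpa using h1
  obtain ⟨hFi, hGi⟩ := injective_of_relTree (F := F) (G := G)
    (fun K hK => ⟨_, hf.dendric K hK s (hs K hK), hpair K hK⟩)
    (fun c => by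
      by_contra! hcon
      exact hf₁ ⟨c, fun a => ⟨f₀ a, by rw [hF, hcon]⟩⟩)
    (fun c => by
      by_contra! hcon
      exact hg ⟨c, fun a => ⟨g₀ a, by rw [hG, hcon]⟩⟩)
  have hFb : Function.Bijective F := hFi.bijective_of_nat_card_le hf.card_le
  have hGb : Function.Bijective G := hGi.bijective_of_nat_card_le hf.card_le
  rcases List.eq_nil_or_concat' s with rfl | ⟨s₁, l, hsl⟩
  · left
    have hfg : f₁ = g := funext fun a => by simpa using hsf a
    subst hfg
    have ht : t = [] := by
      cases t with
      | nil => rfl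
      | cons c t =>
        exfalso
        obtain ⟨a, b, hab⟩ := exists_pair_ne A
        have h1 : ∀ a, F a = c := by
          intro a
          have := htg a
          rw [hF a] at this
          exact (List.cons.inj this).1.symm
        exact hab (hFi ((h1 a).trans (h1 b).symm))
    subst ht
    obtain rfl : f = f₁ := funext fun a => by simpa using htg a
    exact ⟨F, hFi, fun a => hf.length_eq_one hF hG hFb hGb a⟩
  · right
    obtain ⟨l', s₂, hsl'⟩ := List.exists_cons_of_ne_nil (l := s) (by rw [hsl]; simp)
    have hleft : ∀ K, IsDendricLanguage K → ∀ b, (l, b) ∈ biE (Lang f K) [] := by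
      intro K hK b
      obtain ⟨a, rfl⟩ := hFb.2 b
      have h1 := hsf.append_mem hne₁ hK.isLang (hK.mem a)
      rw [hLang₁ K hK] at h1
      exact Lang_factor ⟨s₁, f₀ a, by simp [hsl, hF]⟩ h1
    have hright : ∀ K, IsDendricLanguage K → ∀ b, (b, l') ∈ biE (Lang f K) [] := by
      intro K hK b
      obtain ⟨a, rfl⟩ := hGb.2 b
      have h1 := hsf.append_mem' hgP.ne_nil hK.isLang (hK.mem a)
      rw [← hLang K hK] at h1
      exact Lang_factor ⟨g₀ a, s₂, by simp [hsl', hG]⟩ h1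
    have hstar : ∀ K, IsDendricLanguage K → ∀ p q, [p, q] ∈ Lang f K → p = l ∨ q = l' := by
      intro K hK p q hpq
      by_contra! hcon
      exact hcon.2 ((hf.dendric K hK _ (hf.isLang hK).nil_mem).no_square (hleft K hK l')
        (hright K hK p) (hleft K hK q) hpq hcon.1.symm).symm
    obtain rfl : l = l' := by
      by_contra hll
      obtain ⟨K, hK⟩ := exists_dendricLanguage A
      have h1 : ∀ z ∈ l' :: s₂, z = l' := by
        apply mem_eq_of_isChain_eq
        rw [← hsl']
        refine isChain_of_infix fun p q hpq hp => ?_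
        refine (hstar K hK p q (Lang_factor hpq (hs K hK))).resolve_left ?_
        rw [hp]
        exact fun h => hll h.symm
      exact hll (h1 l (by rw [← hsl', hsl]; simp))
    have hstar' : ∀ a p q, [p, q] <:+: f a → p = l ∨ q = l := by
      intro a p q hpq
      obtain ⟨K, hK⟩ := exists_dendricLanguage A
      exact hstar K hK p q ⟨_, hK.mem a, by simpa using hpq⟩
    have hll : ∀ K, IsDendricLanguage K → [l, l] ∈ Lang f K := fun K hK => hleft K hK l
    by_cases hfirst : ∀ a c t, f a = c :: t → c = l
    · choose f' hf' using fun a => exists_flatMap_lMap _ (f a) le_rfl (hfirst a) (hstar' a)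
      exact ⟨l, lMap l, f', Or.inl rfl,
        hf.of_comp (Or.inl rfl) (fun a => (hf' a).symm) hll, fun a => (hf' a).symm⟩
    · have hlast : ∀ b c t, f b = t ++ [c] → c = l := by
        intro b q r hb
        by_contra hq
        push Not at hfirst
        obtain ⟨a, p, u, ha, hp⟩ := hfirst
        obtain ⟨K, hK, hK'⟩ := exists_dendric_star a
        rcases hstar K hK q p ⟨_, (hK' b).1, r, u, by simp [ha, hb]⟩ with h | h
        · exact hq h
        · exact hp h
      choose f' hf' using fun a => exists_flatMap_rMap _ (f a) le_rfl (hlast a) (hstar' a)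
      exact ⟨l, rMap l, f', Or.inr rfl,
        hf.of_comp (Or.inr rfl) (fun a => (hf' a).symm) hll, fun a => (hf' a).symm⟩

/-! ### Arnoux-Rauzy morphisms preserve dendric words -/

theorem flatMap_singleton_map (e : A → B) (u : List A) :
    u.flatMap (fun a => [e a]) = u.map e := by
  induction u with
  | nil => rfl
  | cons a u ih => simp [ih]

theorem biE_Lang_singleton {K : Set (List A)} (hK : IsLang K) {e : A → B}
    (he : Function.Injective e) (w : List A) :
    biE (Lang (fun a => [e a]) K) (w.map e) = Prod.map e e '' biE K w := by
  ext ⟨c, d⟩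
  constructor
  · rintro ⟨u, hu, s, t, h⟩
    rw [flatMap_singleton_map] at h
    obtain ⟨u₁, t', rfl, h1, -⟩ := List.append_eq_map_iff.1 h
    obtain ⟨s', v, rfl, -, h2⟩ := List.append_eq_map_iff.1 h1.symm
    obtain ⟨a, v', rfl, rfl, h3⟩ := List.map_eq_cons_iff.1 h2
    obtain ⟨w', b', rfl, h4, h5⟩ := List.append_eq_map_iff.1 h3.symm
    obtain ⟨b, r, rfl, rfl, h6⟩ := List.map_eq_cons_iff.1 h5
    obtain rfl := List.map_eq_nil_iff.1 h6
    obtain rfl := he.list_map h4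
    exact ⟨(a, b), hK.factor ⟨s', t', rfl⟩ hu, rfl⟩
  · rintro ⟨⟨a, b⟩, h, h1⟩
    obtain ⟨rfl, rfl⟩ := Prod.mk.inj h1
    refine ⟨_, h, ?_⟩
    rw [flatMap_singleton_map]
    simp

theorem dendricL_Lang_singleton [Finite A] [Finite B] {K : Set (List A)} (hK : IsLang K)
    {e : A → B} (he : Function.Injective e) (h : DendricL K) :
    DendricL (Lang (fun a => [e a]) K) := by
  rintro w ⟨u, hu, s, t, hst⟩
  rw [flatMap_singleton_map] at hst
  obtain ⟨u₁, t', rfl, h1, -⟩ := List.append_eq_map_iff.1 hst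
  obtain ⟨s', v, rfl, -, rfl⟩ := List.append_eq_map_iff.1 h1.symm
  rw [biE_Lang_singleton hK he]
  exact (h v (hK.factor ⟨s', t', rfl⟩ hu)).image he

theorem letterImage_comp {C : Type*} (κ : FreeMonoid B →* FreeMonoid C)
    (τ : FreeMonoid A →* FreeMonoid B) :
    letterImage (κ.comp τ) = fun a => (letterImage τ a).flatMap (letterImage κ) := by
  funext a
  rw [← mapWord_eq_flatMap]
  rfl

theorem letterImage_mul (τ τ' : Monoid.End (FreeMonoid A)) :
    letterImage (τ * τ') = fun a => (letterImage τ' a).flatMap (letterImage τ) :=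
  letterImage_comp τ τ'

theorem dendricL_Lang_of_mem_arMonoid [Finite A] {τ : Monoid.End (FreeMonoid A)}
    (hτ : τ ∈ arMonoid A) {K : Set (List A)} (hK : IsLang K) (hall : ∀ a, [a] ∈ K)
    (hd : DendricL K) :
    IsLang (Lang (letterImage τ) K) ∧ (∀ a, [a] ∈ Lang (letterImage τ) K) ∧
      DendricL (Lang (letterImage τ) K) := by
  induction hτ using Submonoid.closure_induction generalizing K with
  | mem τ hτ =>
    have hL : ∀ l, IsLang (Lang (lMap l) K) ∧ (∀ a, [a] ∈ Lang (lMap l) K) ∧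
        DendricL (Lang (lMap l) K) := fun l =>
      ⟨Lang_isLang (lMap_ne_nil l) hK, fun a => singleton_mem_Lang (hall a) (mem_lMap l a),
        dendricL_Lang_lMap hK (hall l) hd⟩
    rcases hτ with ⟨l, rfl⟩ | ⟨l, rfl⟩
    · rw [letterImage_arL]
      exact hL l
    · rw [letterImage_arR, Lang_rMap hK]
      exact hL l
  | one =>
    have h1 : Lang (letterImage (1 : Monoid.End (FreeMonoid A))) K = K := by
      have h2 : ∀ w : List A, w.flatMap (letterImage (1 : Monoid.End (FreeMonoid A))) = w :=
        fun w => (mapWord_eq_flatMap (1 : Monoid.End (FreeMonoid A)) w).symm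
      ext w
      constructor
      · rintro ⟨u, hu, h⟩
        rw [h2] at h
        exact hK.factor h hu
      · exact fun h => ⟨w, h, by rw [h2]⟩
    rw [h1]
    exact ⟨hK, hall, hd⟩
  | mul τ τ' _ _ ih ih' =>
    rw [letterImage_mul, Lang_comp]
    obtain ⟨h1, h2, h3⟩ := ih' hK hall hd
    exact ih h1 h2 h3

theorem IsBijectiveCoding.exists_letterImage_eq {κ : FreeMonoid A →* FreeMonoid B}
    (h : IsBijectiveCoding κ) :
    ∃ e : A → B, Function.Injective e ∧ letterImage κ = fun a => [e a] := by
  have h1 : ∀ a, ∃ b, letterImage κ a = [b] := fun a => List.length_eq_one_iff.1 (h.1 a)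
  choose e he using h1
  refine ⟨e, fun a b hab => h.2 (FreeMonoid.toList.injective ?_), funext he⟩
  change letterImage κ a = letterImage κ b
  rw [he, he, hab]

/-! ### Decomposition of the dendric preserving morphisms -/

theorem flatMap_map_lMap {e : A → B} (he : Function.Injective e) (l : A) (w : List A) :
    (w.map e).flatMap (lMap (e l)) = (w.flatMap (lMap l)).map e := by
  induction w with
  | nil => rfl
  | cons a w ih =>
    rw [List.map_cons, List.flatMap_cons, List.flatMap_cons, List.map_append, ih]
    by_cases h : a = l
    · simp [h]
    · simp [lMap_of_ne h, lMap_of_ne (he.ne h)]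

theorem flatMap_map_rMap {e : A → B} (he : Function.Injective e) (l : A) (w : List A) :
    (w.map e).flatMap (rMap (e l)) = (w.flatMap (rMap l)).map e := by
  induction w with
  | nil => rfl
  | cons a w ih =>
    rw [List.map_cons, List.flatMap_cons, List.flatMap_cons, List.map_append, ih]
    by_cases h : a = l
    · simp [h]
    · simp [rMap_of_ne h, rMap_of_ne (he.ne h)]

/-- By induction on the total length of the images. The Arnoux-Rauzy morphisms which are factored
out act on the alphabet `B`; they are moved to the right of the coding `e`. -/
theorem Preserving.exists_decomposition [Finite A] [Finite B] [Nontrivial A] [Nontrivial B]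
    {f : A → List B} (hf : Preserving f) :
    ∃ (e : A → B) (τ : Monoid.End (FreeMonoid A)), Function.Injective e ∧ τ ∈ arMonoid A ∧
      ∀ a, f a = (letterImage τ a).map e := by
  have := Fintype.ofFinite A
  induction hn : ∑ a, (f a).length using Nat.strong_induction_on generalizing f with
  | _ n ih =>
    rcases hf.coding_or_comp with ⟨F, hF, h⟩ | ⟨l, m, f', hm, hf', h⟩
    · exact ⟨F, 1, hF, one_mem _, h⟩
    · obtain ⟨e, τ, he, hτ, hτf⟩ := ih _ (hn ▸ sum_length_lt hm hf'.surj h) hf' rfl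
      obtain ⟨a, ha⟩ := hf'.surj l
      rw [hτf, List.mem_map] at ha
      obtain ⟨c, -, rfl⟩ := ha
      rcases hm with rfl | rfl
      · refine ⟨e, arL c * τ, he,
          mul_mem (Submonoid.subset_closure (Or.inl ⟨c, rfl⟩)) hτ, fun a => ?_⟩
        rw [h, hτf, flatMap_map_lMap he, letterImage_mul, letterImage_arL]
      · refine ⟨e, arR c * τ, he,
          mul_mem (Submonoid.subset_closure (Or.inr ⟨c, rfl⟩)) hτ, fun a => ?_⟩
        rw [h, hτf, flatMap_map_rMap he, letterImage_mul, letterImage_arR]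

theorem preserving_letterImage {σ : FreeMonoid A →* FreeMonoid B} (hσ : NonErasing σ)
    (hB : MinimalCodomain σ) (h : DendricPreserving σ hσ) : Preserving (letterImage σ) where
  ne_nil := hσ.letterImage_ne
  surj b := by
    obtain ⟨w, hw⟩ := hB b
    have h1 : b ∈ mapWord σ w.toList := hw
    rw [mapWord_eq_flatMap] at h1
    obtain ⟨a, -, ha⟩ := List.mem_flatMap.1 h1
    exact ⟨a, ha⟩
  dendric := by
    rintro K ⟨x, hx, hd, rfl⟩
    rw [← language_wordImage σ hσ, ← isDendric_iff]
    exact h x hx hd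

end Dendric

theorem mainTheorem1 {A B : Type*} [Finite A] [Finite B] [Nontrivial A] [Nontrivial B]
    (σ : FreeMonoid A →* FreeMonoid B) (hσ : Dendric.NonErasing σ)
    (hB : Dendric.MinimalCodomain σ) :
    Dendric.DendricPreserving σ hσ ↔
      ∃ (κ : FreeMonoid A →* FreeMonoid B) (τ : Monoid.End (FreeMonoid A)),
        Dendric.IsBijectiveCoding κ ∧ τ ∈ Dendric.arMonoid A ∧ σ = κ.comp τ := by
  constructor
  · intro h
    obtain ⟨e, τ, he, hτ, hf⟩ := (Dendric.preserving_letterImage hσ hB h).exists_decomposition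
    refine ⟨FreeMonoid.map e, τ, ⟨fun a => rfl, fun a b hab => ?_⟩, hτ, ?_⟩
    · exact he (FreeMonoid.of_injective hab)
    · exact FreeMonoid.hom_eq fun a => FreeMonoid.toList.injective (hf a)
  · rintro ⟨κ, τ, hκ, hτ, rfl⟩ x hx hd
    have hL := Dendric.language_isLang x
    obtain ⟨e, he, hκe⟩ := hκ.exists_letterImage_eq
    obtain ⟨h1, -, h2⟩ := Dendric.dendricL_Lang_of_mem_arMonoid hτ hL
      (Dendric.isOver_iff.1 hx) ((Dendric.isDendric_iff x).1 hd)
    rw [Dendric.isDendric_iff, Dendric.language_wordImage]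
    have h3 : Dendric.letterImage (κ.comp τ) =
        fun a => (Dendric.letterImage τ a).flatMap (Dendric.letterImage κ) :=
      Dendric.letterImage_comp κ τ
    rw [h3, Dendric.Lang_comp, hκe]
    exact Dendric.dendricL_Lang_singleton h1 he h2
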